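/- Let $R$ be an associative unital ring and let $M$ be an $R$-bimodule that is nilpotent, i.e. $M^{\otimes_R (N+1)}=0$ for some $N\ge 0$, where $M^{\otimes_R 0}=R$ and $M^{\otimes_R(i+1)}=M\otimes_R M^{\otimes_R i}$. Let $T=T_R(M)=\bigoplus_{i\ge 0}M^{\otimes_R i}$ be the tensor ring. Right modules over a ring $A$ are regarded as $A^{\mathrm{op}}$-modules. For an $R$-bimodule $X$ and a right $R$-module $Y$, $\operatorname{Hom}_{R^{\mathrm{op}}}(X,Y)$ is a right $R$-module via $(fr)(x)=f(rx)$. A right $T$-module is written as a pair $[Y,v]$, where $Y$ is its underlying right $R$-module and $v\colon Y\to \operatorname{Hom}_{R^{\mathrm{op}}}(M,Y)$ is the $R^{\mathrm{op}}$-homomorphism $v(y)(m)=ym$. Let $\operatorname{Coind}(Y)=\operatorname{Hom}_{R^{\mathrm{op}}}(T,Y)$ be the right adjoint of the forgetful functor from right $T$-modules to right $R$-modules. A complete injective resolution over a ring $A$ is an exact sequence $I^\bullet=(\cdots\to I^{-1}\to I^0\to I^1\to\cdots)$ of injective $A$-modules such that $\operatorname{Hom}_A(E,I^\bullet)$ is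 exact for every injective $A$-module $E$. An $A$-module is Gorenstein injective if it is isomorphic to $\ker(I^0\to I^1)$ for some complete injective resolution $I^\bullet$. Suppose that (a) $M$ is co-compatible: for every complete injective resolution $I^\bullet$ of $T^{\mathrm{op}}$-modules, the complex $\operatorname{Hom}_{R^{\mathrm{op}}}(M,I^\bullet)$ is exact, and the complex $\operatorname{Hom}_{T^{\mathrm{op}}}(\operatorname{Coind}(\operatorname{Hom}_{R^{\mathrm{op}}}(M,E)),I^\bullet)$ is exact for every injective $R^{\mathrm{op}}$-module $E$; and (b) $M$ is co-admissible: $\operatorname{Ext}^1_{R^{\mathrm{op}}}(\operatorname{Hom}_{R^{\mathrm{op}}}(M^{\otimes_R i},E),H)=0=\operatorname{Ext}^1_{R^{\mathrm{op}}}(M,\operatorname{Hom}_{R^{\mathrm{op}}}(M^{\otimes_R i},H))$ for every Gorenstein injective $R^{\mathrm{op}}$-module $H$, every injective $R^{\mathrm{op}}$-module $E$ and every $i\ge 0$. Then a right $T$-module $[Y,v]$ is Gorenstein injective (as a $T^{\mathrm{op}}$-module) if and only if $v$ is an epimorphism and $\ker v$ is a Gorenstein injective $R^{\mathrm{op}}$-module.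 -/

import Mathlib

open CategoryTheory MulOpposite
open scoped TensorProduct DirectSum

universe u

noncomputable section

namespace TensorRings

/-! ### Tensor product over a (noncommutative) ring -/

section BalTensor

variable (R : Type u) [Ring R]
variable (A : Type u) [AddCommGroup A] [Module Rᵐᵒᵖ A]
variable (B : Type u) [AddCommGroup B] [Module R B]

/-- The subgroup of `A ⊗_ℤ B` generated by the elements `a r ⊗ b - a ⊗ r b`. -/
def balancedRel : AddSubgroup (A ⊗[ℤ] B) :=
  AddSubgroup.closure {t | ∃ (a : A) (r : R) (b : B), t = (op r • a) ⊗ₜ[ℤ] b - a ⊗ₜ[ℤ] (r • b)}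

/-- The tensor product `A ⊗_R B` of a right `R`-module `A` and a left `R`-module `B`. -/
def BalTensor : Type u := (A ⊗[ℤ] B) ⧸ balancedRel R A B

instance : AddCommGroup (BalTensor R A B) :=
  inferInstanceAs (AddCommGroup ((A ⊗[ℤ] B) ⧸ balancedRel R A B))

end BalTensor

namespace BalTensor

variable (R : Type u) [Ring R]
variable {A : Type u} [AddCommGroup A] [Module Rᵐᵒᵖ A]
variable {B : Type u} [AddCommGroup B] [Module R B]

variable (A B) in
/-- The quotient map `A ⊗_ℤ B → A ⊗_R B`. -/
def mk : A ⊗[ℤ] B →+ BalTensor R A B := QuotientAddGroup.mk' (balancedRel R A B)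

/-- The pure tensor `a ⊗ b`, as a biadditive map. -/
def tmulHom : A →+ B →+ BalTensor R A B where
  toFun a :=
    { toFun := fun b => mk R A B (a ⊗ₜ[ℤ] b)
      map_zero' := by rw [TensorProduct.tmul_zero, map_zero]
      map_add' := fun b b' => by rw [TensorProduct.tmul_add, map_add] }
  map_zero' := by
    ext b
    change mk R A B ((0 : A) ⊗ₜ[ℤ] b) = 0
    rw [TensorProduct.zero_tmul, map_zero]
  map_add' a a' := by
    ext b
    change mk R A B ((a + a') ⊗ₜ[ℤ] b) = mk R A B (a ⊗ₜ[ℤ] b) + mk R A B (a' ⊗ₜ[ℤ] b)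
    rw [TensorProduct.add_tmul, map_add]

/-- The pure tensor `a ⊗ b` in `A ⊗_R B`. -/
def tmul (a : A) (b : B) : BalTensor R A B := tmulHom R a b

theorem smul_tmul (r : R) (a : A) (b : B) : tmul R (op r • a) b = tmul R a (r • b) := by
  refine QuotientAddGroup.eq_iff_sub_mem.mpr ?_
  exact AddSubgroup.subset_closure ⟨a, r, b, rfl⟩

theorem add_tmul (a a' : A) (b : B) : tmul R (a + a') b = tmul R a b + tmul R a' b :=
  DFunLike.congr_fun (map_add (tmulHom R) a a') b

theorem tmul_add (a : A) (b b' : B) : tmul R a (b + b') = tmul R a b + tmul R a b' :=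
  map_add (tmulHom R a) b b'

theorem zero_tmul (b : B) : tmul R (0 : A) b = 0 :=
  DFunLike.congr_fun (map_zero (tmulHom R)) b

theorem tmul_zero (a : A) : tmul R a (0 : B) = 0 := map_zero (tmulHom R a)

variable {R} in
@[elab_as_elim]
theorem induction_on {p : BalTensor R A B → Prop} (t : BalTensor R A B)
    (zero : p 0) (tmul : ∀ a b, p (tmul R a b)) (add : ∀ x y, p x → p y → p (x + y)) : p t := by
  obtain ⟨s, rfl⟩ := QuotientAddGroup.mk'_surjective (balancedRel R A B) t
  change p (mk R A B s)
  induction s using TensorProduct.induction_on with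
  | zero => rw [map_zero]; exact zero
  | tmul a b => exact tmul a b
  | add x y hx hy => rw [map_add]; exact add _ _ hx hy

variable {R} in
theorem hom_ext {C : Type*} [AddCommGroup C] {f g : BalTensor R A B →+ C}
    (h : ∀ a b, f (tmul R a b) = g (tmul R a b)) : f = g := by
  ext t
  induction t using induction_on with
  | zero => rw [map_zero, map_zero]
  | tmul a b => exact h a b
  | add x y hx hy => rw [map_add, map_add, hx, hy]

/-- The additive map out of `A ⊗_R B` induced by an `R`-balanced biadditive map. -/
def lift {C : Type*} [AddCommGroup C] (f : A →+ B →+ C)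
    (hf : ∀ (r : R) a b, f (op r • a) b = f a (r • b)) : BalTensor R A B →+ C :=
  QuotientAddGroup.lift (balancedRel R A B)
    (TensorProduct.liftAddHom f fun n a b => by
      rw [map_zsmul, map_zsmul, AddMonoidHom.zsmul_apply])
    (by
      rw [balancedRel, AddSubgroup.closure_le]
      rintro _ ⟨a, r, b, rfl⟩
      rw [SetLike.mem_coe, AddMonoidHom.mem_ker, map_sub, TensorProduct.liftAddHom_tmul,
        TensorProduct.liftAddHom_tmul, hf, sub_self])

theorem lift_tmul {C : Type*} [AddCommGroup C] (f : A →+ B →+ C)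
    (hf : ∀ (r : R) a b, f (op r • a) b = f a (r • b)) (a : A) (b : B) :
    lift R f hf (tmul R a b) = f a b := rfl

section Left

variable [Module R A] [SMulCommClass R Rᵐᵒᵖ A]

/-- Left multiplication `r (a ⊗ b) = r a ⊗ b`. -/
def smulLeft (r : R) : BalTensor R A B →+ BalTensor R A B :=
  lift R ((tmulHom R).comp (DistribSMul.toAddMonoidHom A r)) (fun s a b => by
    change tmul R (r • op s • a) b = tmul R (r • a) (s • b)
    rw [smul_comm, smul_tmul])

theorem smulLeft_tmul (r : R) (a : A) (b : B) : smulLeft R r (tmul R a b) = tmul R (r • a) b := rfl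

instance : Module R (BalTensor R A B) where
  smul r t := smulLeft R r t
  one_smul t := DFunLike.congr_fun (f := smulLeft R (1 : R)) (g := AddMonoidHom.id _)
    (hom_ext fun a b => by rw [smulLeft_tmul, one_smul, AddMonoidHom.id_apply]) t
  mul_smul r s t := DFunLike.congr_fun (f := smulLeft R (r * s))
    (g := (smulLeft R r).comp (smulLeft R s))
    (hom_ext fun a b => by
      rw [AddMonoidHom.comp_apply, smulLeft_tmul, smulLeft_tmul, smulLeft_tmul, mul_smul]) t
  smul_zero r := map_zero (smulLeft R r)
  smul_add r := map_add (smulLeft R r)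
  add_smul r s t := DFunLike.congr_fun (f := smulLeft R (r + s)) (g := smulLeft R r + smulLeft R s)
    (hom_ext fun a b => by
      rw [AddMonoidHom.add_apply, smulLeft_tmul, smulLeft_tmul, smulLeft_tmul, add_smul,
        add_tmul]) t
  zero_smul t := DFunLike.congr_fun (f := smulLeft R (0 : R)) (g := 0)
    (hom_ext fun a b => by
      rw [AddMonoidHom.zero_apply, smulLeft_tmul, zero_smul, zero_tmul]) t

theorem smul_left_tmul (r : R) (a : A) (b : B) : r • tmul R a b = tmul R (r • a) b := rfl

end Left

section Right

variable [Module Rᵐᵒᵖ B] [SMulCommClass R Rᵐᵒᵖ B]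

/-- Right multiplication `(a ⊗ b) r = a ⊗ b r`. -/
def smulRight (r : Rᵐᵒᵖ) : BalTensor R A B →+ BalTensor R A B :=
  lift R ((AddMonoidHom.compHom.flip (DistribSMul.toAddMonoidHom B r)).comp (tmulHom R))
    (fun s a b => by
      change tmul R (op s • a) (r • b) = tmul R a (r • s • b)
      rw [smul_tmul, smul_comm])

theorem smulRight_tmul (r : Rᵐᵒᵖ) (a : A) (b : B) :
    smulRight R r (tmul R a b) = tmul R a (r • b) := rfl

instance : Module Rᵐᵒᵖ (BalTensor R A B) where
  smul r t := smulRight R r t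
  one_smul t := DFunLike.congr_fun (f := smulRight R (1 : Rᵐᵒᵖ)) (g := AddMonoidHom.id _)
    (hom_ext fun a b => by rw [smulRight_tmul, one_smul, AddMonoidHom.id_apply]) t
  mul_smul r s t := DFunLike.congr_fun (f := smulRight R (r * s))
    (g := (smulRight R r).comp (smulRight R s))
    (hom_ext fun a b => by
      rw [AddMonoidHom.comp_apply, smulRight_tmul, smulRight_tmul, smulRight_tmul, mul_smul]) t
  smul_zero r := map_zero (smulRight R r)
  smul_add r := map_add (smulRight R r)
  add_smul r s t := DFunLike.congr_fun (f := smulRight R (r + s))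
    (g := smulRight R r + smulRight R s)
    (hom_ext fun a b => by
      rw [AddMonoidHom.add_apply, smulRight_tmul, smulRight_tmul, smulRight_tmul, add_smul,
        tmul_add]) t
  zero_smul t := DFunLike.congr_fun (f := smulRight R (0 : Rᵐᵒᵖ)) (g := 0)
    (hom_ext fun a b => by
      rw [AddMonoidHom.zero_apply, smulRight_tmul, zero_smul, tmul_zero]) t

theorem smul_right_tmul (r : Rᵐᵒᵖ) (a : A) (b : B) : r • tmul R a b = tmul R a (r • b) := rfl

end Right

instance [Module R A] [SMulCommClass R Rᵐᵒᵖ A] [Module Rᵐᵒᵖ B] [SMulCommClass R Rᵐᵒᵖ B] :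
    SMulCommClass R Rᵐᵒᵖ (BalTensor R A B) where
  smul_comm r s t := DFunLike.congr_fun (f := (smulLeft R r).comp (smulRight R s))
    (g := (smulRight R s).comp (smulLeft R r)) (hom_ext fun a b => by
      rw [AddMonoidHom.comp_apply, AddMonoidHom.comp_apply, smulLeft_tmul, smulRight_tmul,
        smulRight_tmul, smulLeft_tmul]) t

end BalTensor

/-! ### Tensor powers of a bimodule -/

/-- A bundled `R`-bimodule; right `R`-modules are modules over `Rᵐᵒᵖ`. -/
structure Bimodule (R : Type u) [Ring R] where
  carrier : Type u
  [addCommGroup : AddCommGroup carrier]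
  [left : Module R carrier]
  [right : Module Rᵐᵒᵖ carrier]
  [smulComm : SMulCommClass R Rᵐᵒᵖ carrier]

attribute [instance] Bimodule.addCommGroup Bimodule.left Bimodule.right Bimodule.smulComm

variable (R : Type u) [Ring R]
variable (M : Type u) [AddCommGroup M] [Module R M] [Module Rᵐᵒᵖ M] [SMulCommClass R Rᵐᵒᵖ M]

/-- The tensor powers as bundled bimodules: `R` in degree `0`, and `M ⊗_R (i-th power)` in
degree `i + 1`. -/
def tensorPowerBimodule : ℕ → Bimodule R
  | 0 => ⟨R⟩
  | i + 1 => ⟨BalTensor R M (tensorPowerBimodule i).carrier⟩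

/-- The tensor power `M^{⊗_R i}`. -/
abbrev TPow (i : ℕ) : Type u := (tensorPowerBimodule R M i).carrier

/-- `M` is `N`-nilpotent if `M^{⊗_R (N+1)} = 0`. -/
def IsNilpotentBimodule (N : ℕ) : Prop := Subsingleton (TPow R M (N + 1))

namespace TPow

/-- The identification `R = M^{⊗ 0}`. -/
def scalar : R ≃+ TPow R M 0 := AddEquiv.refl R

/-- `m ↦ x ↦ m ⊗ x`, from `M` and `M^{⊗ i}` to `M^{⊗ (i+1)}`. -/
def cons (i : ℕ) : M →+ TPow R M i →+ TPow R M (i + 1) :=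
  BalTensor.tmulHom R

theorem cons_op_smul (i : ℕ) (r : R) (m : M) (x : TPow R M i) :
    cons R M i (op r • m) x = cons R M i m (r • x) :=
  BalTensor.smul_tmul R r m x

theorem smul_cons (i : ℕ) (r : R) (m : M) (x : TPow R M i) :
    r • cons R M i m x = cons R M i (r • m) x := rfl

theorem op_smul_cons (i : ℕ) (r : Rᵐᵒᵖ) (m : M) (x : TPow R M i) :
    r • cons R M i m x = cons R M i m (r • x) := rfl

theorem smul_scalar (r s : R) : r • scalar R M s = scalar R M (r * s) := rfl

theorem op_smul_scalar (r s : R) : op r • scalar R M s = scalar R M (s * r) := rfl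

variable {R M} in
@[elab_as_elim]
theorem succ_induction {i : ℕ} {p : TPow R M (i + 1) → Prop} (t : TPow R M (i + 1))
    (zero : p 0) (cons : ∀ m x, p (cons R M i m x)) (add : ∀ x y, p x → p y → p (x + y)) : p t :=
  BalTensor.induction_on (p := p) t zero cons add

/-- The additive map out of `M^{⊗ (i+1)}` induced by a balanced biadditive map. -/
def succLift {C : Type*} [AddCommGroup C] (i : ℕ) (f : M →+ TPow R M i →+ C)
    (hf : ∀ (r : R) m x, f (op r • m) x = f m (r • x)) : TPow R M (i + 1) →+ C :=
  BalTensor.lift R f hf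

theorem succLift_cons {C : Type*} [AddCommGroup C] (i : ℕ) (f : M →+ TPow R M i →+ C)
    (hf : ∀ (r : R) m x, f (op r • m) x = f m (r • x)) (m : M) (x : TPow R M i) :
    succLift R M i f hf (cons R M i m x) = f m x := rfl

end TPow

/-! ### The tensor ring -/

/-- The tensor ring `T_R(M) = ⨁ i, M^{⊗_R i}`. -/
def TensorRing : Type u := ⨁ i, TPow R M i

namespace TensorRing

instance instAddCommGroup : AddCommGroup (TensorRing R M) :=
  inferInstanceAs (AddCommGroup (⨁ i, TPow R M i))

instance instModule : Module R (TensorRing R M) := inferInstanceAs (Module R (⨁ i, TPow R M i))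

/-- The inclusion of the `i`-th homogeneous component. -/
def of (i : ℕ) : TPow R M i →+ TensorRing R M := DirectSum.of (fun i => TPow R M i) i

/-- The additive map out of `T_R(M)` given by its restrictions to the homogeneous components. -/
def toAdd {C : Type*} [AddCommGroup C] (f : ∀ i, TPow R M i →+ C) : TensorRing R M →+ C :=
  DirectSum.toAddMonoid f

theorem toAdd_of {C : Type*} [AddCommGroup C] (f : ∀ i, TPow R M i →+ C) (i : ℕ)
    (x : TPow R M i) : toAdd R M f (of R M i x) = f i x :=
  DirectSum.toAddMonoid_of f i x

variable {R M} in
@[elab_as_elim]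
theorem induction_on {p : TensorRing R M → Prop} (t : TensorRing R M) (zero : p 0)
    (of : ∀ i x, p (of R M i x)) (add : ∀ x y, p x → p y → p (x + y)) : p t :=
  DirectSum.induction_on (motive := p) t zero of add

theorem smul_of (r : R) (i : ℕ) (x : TPow R M i) : r • of R M i x = of R M i (r • x) :=
  ((DirectSum.lof R ℕ (fun i => TPow R M i) i).map_smul r x).symm

/-- Left multiplication by a scalar. -/
def lsmul : R →+ TensorRing R M →+ TensorRing R M :=
  (Module.toAddMonoidEnd R (TensorRing R M)).toAddMonoidHom

theorem lsmul_apply (r : R) (t : TensorRing R M) : lsmul R M r t = r • t := rfl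

/-- Left multiplication by an element of `M`: it maps `x` in degree `i` to `m ⊗ x` in degree
`i + 1`. -/
def shift : M →+ TensorRing R M →+ TensorRing R M :=
  (toAdd R M fun i => ((of R M (i + 1)).compHom.comp (TPow.cons R M i)).flip).flip

theorem shift_of (m : M) (i : ℕ) (x : TPow R M i) :
    shift R M m (of R M i x) = of R M (i + 1) (TPow.cons R M i m x) :=
  DFunLike.congr_fun (toAdd_of R M
    (fun i => ((of R M (i + 1)).compHom.comp (TPow.cons R M i)).flip) i x) m

theorem shift_op_smul (r : R) (m : M) (t : TensorRing R M) :
    shift R M (op r • m) t = shift R M m (r • t) := by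
  refine induction_on t ?_ (fun i x => ?_) (fun x y hx hy => ?_)
  · rw [smul_zero, map_zero, map_zero]
  · rw [shift_of, smul_of, shift_of, TPow.cons_op_smul]
  · rw [smul_add, map_add, map_add, hx, hy]

theorem shift_smul (r : R) (m : M) (t : TensorRing R M) :
    shift R M (r • m) t = r • shift R M m t := by
  refine induction_on t ?_ (fun i x => ?_) (fun x y hx hy => ?_)
  · rw [map_zero, map_zero, smul_zero]
  · rw [shift_of, shift_of, smul_of, TPow.smul_cons]
  · rw [map_add, map_add, smul_add, hx, hy]

/-- Left multiplication by elements of `M^{⊗ i}`, determined by `r · t = r t` in degree `0` and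
`(m ⊗ x) · t = m ⊗ (x · t)`. -/
def mulAux : ∀ i : ℕ, {f : TPow R M i →+ TensorRing R M →+ TensorRing R M //
    ∀ (r : R) x t, f (r • x) t = r • f x t}
  | 0 => ⟨(lsmul R M).comp (TPow.scalar R M).symm.toAddMonoidHom,
      fun r x t => mul_smul r ((TPow.scalar R M).symm x) t⟩
  | i + 1 =>
    ⟨TPow.succLift R M i
      ((AddMonoidHom.compHom.flip (mulAux i).1).comp (AddMonoidHom.compHom.comp (shift R M)))
      (fun r m x => by
        ext t
        change shift R M (op r • m) ((mulAux i).1 x t) = shift R M m ((mulAux i).1 (r • x) t)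
        rw [(mulAux i).2, shift_op_smul]),
    fun r x t => by
      refine TPow.succ_induction x ?_ (fun m y => ?_) (fun y z hy hz => ?_)
      · rw [smul_zero, map_zero, AddMonoidHom.zero_apply, smul_zero]
      · rw [TPow.smul_cons, TPow.succLift_cons, TPow.succLift_cons]
        exact shift_smul R M r m _
      · rw [smul_add, map_add, map_add, AddMonoidHom.add_apply, AddMonoidHom.add_apply, smul_add,
          hy, hz]⟩

/-- The multiplication of the tensor ring, the biadditive extension of the concatenation
`M^{⊗ i} × M^{⊗ j} → M^{⊗ (i+j)}`. -/
def mulHom : TensorRing R M →+ TensorRing R M →+ TensorRing R M :=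
  toAdd R M fun i => (mulAux R M i).1

theorem mulHom_of (i : ℕ) (x : TPow R M i) : mulHom R M (of R M i x) = (mulAux R M i).1 x :=
  toAdd_of R M _ i x

theorem mulHom_scalar (r : R) (t : TensorRing R M) :
    mulHom R M (of R M 0 (TPow.scalar R M r)) t = r • t := by
  rw [mulHom_of]
  rfl

theorem mulHom_cons (i : ℕ) (m : M) (x : TPow R M i) (t : TensorRing R M) :
    mulHom R M (of R M (i + 1) (TPow.cons R M i m x)) t =
      shift R M m (mulHom R M (of R M i x) t) := by
  rw [mulHom_of, mulHom_of]
  rfl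

theorem mulHom_smul (r : R) (s t : TensorRing R M) :
    mulHom R M (r • s) t = r • mulHom R M s t := by
  refine induction_on s ?_ (fun i x => ?_) (fun x y hx hy => ?_)
  · rw [smul_zero, map_zero, AddMonoidHom.zero_apply, smul_zero]
  · rw [smul_of, mulHom_of, mulHom_of, (mulAux R M i).2]
  · rw [smul_add, map_add, map_add, AddMonoidHom.add_apply, AddMonoidHom.add_apply, hx, hy,
      smul_add]

theorem mulHom_shift (m : M) (s t : TensorRing R M) :
    mulHom R M (shift R M m s) t = shift R M m (mulHom R M s t) := by
  refine induction_on s ?_ (fun i x => ?_) (fun x y hx hy => ?_)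
  · rw [map_zero, map_zero, AddMonoidHom.zero_apply, map_zero]
  · rw [shift_of, mulHom_cons]
  · rw [map_add, map_add, map_add, AddMonoidHom.add_apply, AddMonoidHom.add_apply, map_add, hx, hy]

theorem mulHom_of_assoc (i : ℕ) (x : TPow R M i) (s t : TensorRing R M) :
    mulHom R M (mulHom R M (of R M i x) s) t = mulHom R M (of R M i x) (mulHom R M s t) := by
  induction i with
  | zero =>
    obtain ⟨r, rfl⟩ := (TPow.scalar R M).surjective x
    rw [mulHom_scalar, mulHom_scalar, mulHom_smul]
  | succ i ih =>
    refine TPow.succ_induction x ?_ (fun m y => ?_) (fun y z hy hz => ?_)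
    · rw [map_zero, map_zero, AddMonoidHom.zero_apply, AddMonoidHom.zero_apply, map_zero,
        AddMonoidHom.zero_apply]
    · rw [mulHom_cons, mulHom_cons, mulHom_shift, ih]
    · rw [map_add, map_add, AddMonoidHom.add_apply, AddMonoidHom.add_apply, map_add,
        AddMonoidHom.add_apply, hy, hz]

theorem mulHom_assoc (s t w : TensorRing R M) :
    mulHom R M (mulHom R M s t) w = mulHom R M s (mulHom R M t w) := by
  refine induction_on s ?_ (fun i x => ?_) (fun x y hx hy => ?_)
  · rw [map_zero, AddMonoidHom.zero_apply, AddMonoidHom.zero_apply, map_zero,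
      AddMonoidHom.zero_apply]
  · exact mulHom_of_assoc R M i x t w
  · rw [map_add, AddMonoidHom.add_apply, AddMonoidHom.add_apply, map_add, AddMonoidHom.add_apply,
      hx, hy]

/-- The unit of the tensor ring, `1 ∈ R` in degree `0`. -/
def unit : TensorRing R M := of R M 0 (TPow.scalar R M 1)

theorem mulHom_unit_left (t : TensorRing R M) : mulHom R M (unit R M) t = t := by
  rw [unit, mulHom_scalar, one_smul]

theorem mulHom_of_unit (i : ℕ) (x : TPow R M i) :
    mulHom R M (of R M i x) (unit R M) = of R M i x := by
  induction i with
  | zero =>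
    obtain ⟨r, rfl⟩ := (TPow.scalar R M).surjective x
    rw [mulHom_scalar, unit, smul_of, TPow.smul_scalar, mul_one]
  | succ i ih =>
    refine TPow.succ_induction x ?_ (fun m y => ?_) (fun y z hy hz => ?_)
    · rw [map_zero, map_zero, AddMonoidHom.zero_apply]
    · rw [mulHom_cons, ih, shift_of]
    · rw [map_add, map_add, AddMonoidHom.add_apply, hy, hz]

theorem mulHom_unit_right (t : TensorRing R M) : mulHom R M t (unit R M) = t := by
  refine induction_on t ?_ (fun i x => ?_) (fun x y hx hy => ?_)
  · rw [map_zero, AddMonoidHom.zero_apply]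
  · exact mulHom_of_unit R M i x
  · rw [map_add, AddMonoidHom.add_apply, hx, hy]

instance instRing : Ring (TensorRing R M) where
  __ := instAddCommGroup R M
  mul s t := mulHom R M s t
  one := unit R M
  mul_assoc s t w := mulHom_assoc R M s t w
  one_mul t := mulHom_unit_left R M t
  mul_one t := mulHom_unit_right R M t
  left_distrib s t w := map_add (mulHom R M s) t w
  right_distrib s t w := DFunLike.congr_fun (map_add (mulHom R M) s t) w
  zero_mul t := DFunLike.congr_fun (map_zero (mulHom R M)) t
  mul_zero s := map_zero (mulHom R M s)

theorem mul_def (s t : TensorRing R M) : s * t = mulHom R M s t := rfl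

/-- The inclusion `R → T_R(M)` as the component of degree `0`. -/
def incl : R →+* TensorRing R M where
  toFun r := of R M 0 (TPow.scalar R M r)
  map_one' := rfl
  map_mul' r s := by rw [mul_def, mulHom_scalar, smul_of, TPow.smul_scalar]
  map_zero' := by rw [map_zero, map_zero]
  map_add' r s := by rw [map_add, map_add]

/-- The inclusion `M ≅ M ⊗_R R → T_R(M)` as the component of degree `1`. -/
def gen : M →+ TensorRing R M where
  toFun m := of R M 1 (TPow.cons R M 0 m (TPow.scalar R M 1))
  map_zero' := by rw [map_zero, AddMonoidHom.zero_apply, map_zero]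
  map_add' m m' := by rw [map_add, AddMonoidHom.add_apply, map_add]

theorem incl_apply (r : R) : incl R M r = of R M 0 (TPow.scalar R M r) := rfl

theorem gen_apply (m : M) : gen R M m = of R M 1 (TPow.cons R M 0 m (TPow.scalar R M 1)) := rfl

theorem incl_mul (r : R) (t : TensorRing R M) : incl R M r * t = r • t :=
  mulHom_scalar R M r t

theorem gen_mul (m : M) (t : TensorRing R M) : gen R M m * t = shift R M m t := by
  rw [gen_apply, mul_def, mulHom_cons, mulHom_scalar, one_smul]

theorem gen_smul (r : R) (m : M) : gen R M (r • m) = incl R M r * gen R M m := by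
  rw [incl_mul, gen_apply, gen_apply, smul_of, TPow.smul_cons]

theorem gen_op_smul (r : R) (m : M) : gen R M (op r • m) = gen R M m * incl R M r := by
  rw [gen_mul, incl_apply, gen_apply, shift_of, TPow.cons_op_smul, TPow.smul_scalar, mul_one]

end TensorRing

/-! ### The right module `Hom_{R^op}(X, Y)` -/

section RHom

variable (X : Type u) [AddCommGroup X] [Module Rᵐᵒᵖ X]
variable (Y : Type u) [AddCommGroup Y] [Module Rᵐᵒᵖ Y]

/-- The group `Hom_{R^op}(X, Y)` of maps of right `R`-modules. It is a type of its own, because it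
carries the right `R`-module structure that comes from the left structure of a bimodule `X`. -/
def RHom : Type u := X →ₗ[Rᵐᵒᵖ] Y

instance : AddCommGroup (RHom R X Y) := inferInstanceAs (AddCommGroup (X →ₗ[Rᵐᵒᵖ] Y))

namespace RHom

/-- An element of `Hom_{R^op}(X, Y)` as a linear map. -/
def equiv : RHom R X Y ≃+ (X →ₗ[Rᵐᵒᵖ] Y) := AddEquiv.refl _

variable {R X Y} in
theorem ext {f g : RHom R X Y} (h : ∀ x, equiv R X Y f x = equiv R X Y g x) : f = g :=
  (equiv R X Y).injective (LinearMap.ext h)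

variable [Module R X] [SMulCommClass R Rᵐᵒᵖ X]

/-- Left multiplication by `r` on `X`, as a map of right modules. -/
def lmul (r : R) : X →ₗ[Rᵐᵒᵖ] X where
  toFun x := r • x
  map_add' x y := smul_add r x y
  map_smul' s x := smul_comm r s x

/-- The right multiplication on `Hom_{R^op}(X, Y)`, given by `(f r)(x) = f (r x)`. -/
instance : SMul Rᵐᵒᵖ (RHom R X Y) where
  smul r f := (equiv R X Y).symm ((equiv R X Y f).comp (lmul R X (unop r)))

theorem smul_apply (r : Rᵐᵒᵖ) (f : RHom R X Y) (x : X) :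
    equiv R X Y (r • f) x = equiv R X Y f (unop r • x) := rfl

instance : Module Rᵐᵒᵖ (RHom R X Y) where
  one_smul f := ext fun x => by rw [smul_apply, unop_one, one_smul]
  mul_smul r s f := ext fun x => by
    rw [smul_apply, smul_apply, smul_apply, unop_mul, mul_smul]
  smul_zero r := ext fun x => by rw [smul_apply, map_zero, LinearMap.zero_apply,
    LinearMap.zero_apply]
  smul_add r f g := ext fun x => by
    rw [smul_apply, map_add, map_add, LinearMap.add_apply, LinearMap.add_apply, smul_apply,
      smul_apply]
  add_smul r s f := ext fun x => by
    rw [smul_apply, map_add, LinearMap.add_apply, smul_apply, smul_apply, MulOpposite.unop_add,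
      add_smul, map_add]
  zero_smul f := ext fun x => by
    rw [smul_apply, unop_zero, zero_smul, map_zero, map_zero, LinearMap.zero_apply]

end RHom

end RHom

/-! ### Right modules over the tensor ring -/

/-- The forgetful functor `U : Mod(T_R(M)^op) ⥤ Mod(R^op)`. -/
abbrev forgetful : ModuleCat.{u} (TensorRing R M)ᵐᵒᵖ ⥤ ModuleCat.{u} Rᵐᵒᵖ :=
  ModuleCat.restrictScalars (TensorRing.incl R M).op

/-- The functor `Coind = Hom_{R^op}(T_R(M), -)`, right adjoint to the forgetful functor. -/
abbrev coind : ModuleCat.{u} Rᵐᵒᵖ ⥤ ModuleCat.{u} (TensorRing R M)ᵐᵒᵖ :=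
  ModuleCat.coextendScalars (TensorRing.incl R M).op

variable {R M} in
/-- The `R^op`-linear map `v : Y → Hom_{R^op}(M, Y)`, `v(y)(m) = y m`, of a right
`T_R(M)`-module, which is thereby viewed as the pair `[Y, v]`. -/
def structureMap (Y : ModuleCat.{u} (TensorRing R M)ᵐᵒᵖ) :
    (forgetful R M).obj Y →ₗ[Rᵐᵒᵖ] RHom R M ((forgetful R M).obj Y) where
  toFun y := (RHom.equiv R M ((forgetful R M).obj Y)).symm
    { toFun := fun m => (op (TensorRing.gen R M m) • (y : Y) : Y)
      map_add' := fun m m' => by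
        rw [map_add, MulOpposite.op_add]
        exact add_smul (op (TensorRing.gen R M m)) (op (TensorRing.gen R M m')) (y : Y)
      map_smul' := fun r m => by
        have h := TensorRing.gen_op_smul R M (unop r) m
        rw [op_unop] at h
        rw [h, op_mul]
        exact mul_smul (op (TensorRing.incl R M (unop r))) (op (TensorRing.gen R M m)) (y : Y) }
  map_add' y y' := RHom.ext fun m => smul_add (op (TensorRing.gen R M m)) (y : Y) (y' : Y)
  map_smul' r y := RHom.ext fun m => by
    change op (TensorRing.gen R M m) • (op (TensorRing.incl R M (unop r)) • (y : Y)) =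
      op (TensorRing.gen R M (unop r • m)) • (y : Y)
    rw [TensorRing.gen_smul, op_mul, mul_smul]

variable {R M} in
theorem structureMap_apply (Y : ModuleCat.{u} (TensorRing R M)ᵐᵒᵖ) (y : Y) (m : M) :
    RHom.equiv R M ((forgetful R M).obj Y) (structureMap Y y) m =
      (op (TensorRing.gen R M m) • y : Y) := rfl

/-! ### Gorenstein injective modules -/

section Gorenstein

variable {A : Type u} [Ring A]

/-- The complex of abelian groups `Hom_A(E, I)` is exact. -/
def HomExact (E : ModuleCat.{u} A) (I : CochainComplex (ModuleCat.{u} A) ℤ) : Prop :=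
  (((preadditiveCoyoneda.obj (Opposite.op E)).mapHomologicalComplex _).obj I).Acyclic

/-- An exact complex of injective modules which stays exact under `Hom_A(E, -)` for every
injective module `E`. -/
structure IsCompleteInjectiveResolution (I : CochainComplex (ModuleCat.{u} A) ℤ) : Prop where
  exact : I.Acyclic
  injective : ∀ n, Injective (I.X n)
  homExact : ∀ E : ModuleCat.{u} A, Injective E → HomExact E I

variable (A) in
/-- The class of Gorenstein injective `A`-modules. -/
def gorensteinInjective : ObjectProperty (ModuleCat.{u} A) := fun X =>
  ∃ I : CochainComplex (ModuleCat.{u} A) ℤ,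
    IsCompleteInjectiveResolution I ∧ Nonempty (X ≅ Limits.kernel (I.d 0 1))

end Gorenstein

/-! ### Co-compatible and co-admissible bimodules, and the class `Ψ` -/

/-- The `R`-bimodule `X` is co-compatible (relative to the tensor ring `T_R(M)`). -/
structure IsCoCompatible (X : Type u) [AddCommGroup X] [Module R X] [Module Rᵐᵒᵖ X]
    [SMulCommClass R Rᵐᵒᵖ X] : Prop where
  exact_hom : ∀ I : CochainComplex (ModuleCat.{u} (TensorRing R M)ᵐᵒᵖ) ℤ,
    IsCompleteInjectiveResolution I →
      HomExact (ModuleCat.of Rᵐᵒᵖ X) (((forgetful R M).mapHomologicalComplex _).obj I)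
  exact_hom_coind : ∀ I : CochainComplex (ModuleCat.{u} (TensorRing R M)ᵐᵒᵖ) ℤ,
    IsCompleteInjectiveResolution I → ∀ E : ModuleCat.{u} Rᵐᵒᵖ, Injective E →
      HomExact ((coind R M).obj (ModuleCat.of Rᵐᵒᵖ (RHom R X E))) I

/-- The `R`-bimodule `X` is co-admissible. -/
structure IsCoAdmissible (X : Type u) [AddCommGroup X] [Module R X] [Module Rᵐᵒᵖ X]
    [SMulCommClass R Rᵐᵒᵖ X] : Prop where
  ext_hom_injective : ∀ H E : ModuleCat.{u} Rᵐᵒᵖ, gorensteinInjective Rᵐᵒᵖ H → Injective E →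
    ∀ i : ℕ, Subsingleton (Abelian.Ext.{u} (ModuleCat.of Rᵐᵒᵖ (RHom R (TPow R X i) E)) H 1)
  ext_hom_gorenstein : ∀ H : ModuleCat.{u} Rᵐᵒᵖ, gorensteinInjective Rᵐᵒᵖ H →
    ∀ i : ℕ, Subsingleton
      (Abelian.Ext.{u} (ModuleCat.of Rᵐᵒᵖ X) (ModuleCat.of Rᵐᵒᵖ (RHom R (TPow R X i) H)) 1)

/-- The class `Ψ(𝒴)` of right `T_R(M)`-modules `[Y, v]` with `v` an epimorphism and
`ker v` in `𝒴`. -/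
def Psi (𝒴 : ObjectProperty (ModuleCat.{u} Rᵐᵒᵖ)) :
    ObjectProperty (ModuleCat.{u} (TensorRing R M)ᵐᵒᵖ) := fun Y =>
  Function.Surjective (structureMap Y) ∧
    𝒴 (ModuleCat.of Rᵐᵒᵖ (LinearMap.ker (structureMap Y)))

end TensorRings

end

/-!
For a right `T`-module `[Y, v]`, the maps `[X, 0] → [Y, v]` are the maps `X → ker v`. When `v` is
surjective, `ker` stays exact on sequences starting at `[Y, v]`, and this adjunction gives
`Ext¹([X, 0], [Y, v]) = 0 ↔ Ext¹(X, ker v) = 0`. The sequence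
`0 → [E, 0] → Coind(E) → Coind(Hom(M, E)) → 0` links the modules `[E, 0]` to the coinduced ones,
among whose summands are all injective `T`-modules.

A module is Gorenstein injective exactly when it lies on a chain `(Xₙ)`, `n : ℤ`, of modules such
that `Xₙ₊₁` is the cokernel of an embedding of `Xₙ` in an injective module and
`Ext¹(J, Xₙ) = 0` for all injective `J`. Applying `ker` to such a chain over `T` gives one over
`R`; here co-compatibility makes the structure maps surjective and gives the vanishing.

Conversely, nilpotency of `M` makes the filtration of `Y` by the kernels of the action maps
`Y → Hom(M^{⊗ k}, Y)` finite, so `Y` is controlled by `ker v`. An embedding of `ker v` in an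
injective module `E`, or a surjection of `E` onto it, therefore lifts to an embedding of `Y` in
`Coind(E)`, or a surjection of `Coind(E)` onto `Y`, which builds the chain through `Y`. The groups
`Ext¹(Coind(Hom(M^{⊗ i}, E)), Y)` vanish for large `i` by nilpotency, and the sequence above with
`Hom(M^{⊗ i}, E)` in place of `E` descends from `i + 1` to `i`.
-/

noncomputable section

namespace TensorRings

/-! ### Extension groups and cosyzygies -/

section Ext

open Abelian (Ext)

universe w v

variable {C : Type*} [Category.{v} C] [Abelian C] [HasExt.{w} C]

theorem ext_subsingleton_of_retract_left {X X' : C} (h : Retract X X') (Y : C) (n : ℕ)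
    [Subsingleton (Ext.{w} X' Y n)] : Subsingleton (Ext.{w} X Y n) := by
  refine subsingleton_of_forall_eq 0 fun x => ?_
  rw [← Ext.mk₀_id_comp x, ← h.retract, ← Ext.mk₀_comp_mk₀_assoc,
    Subsingleton.elim ((Ext.mk₀ h.r).comp x (zero_add n)) 0, Ext.comp_zero]

theorem ext_subsingleton_of_retract_right (X : C) {Y Y' : C} (h : Retract Y Y') (n : ℕ)
    [Subsingleton (Ext.{w} X Y' n)] : Subsingleton (Ext.{w} X Y n) := by
  refine subsingleton_of_forall_eq 0 fun x => ?_
  rw [← Ext.comp_mk₀_id x, ← h.retract, ← Ext.mk₀_comp_mk₀,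
    ← Ext.comp_assoc_of_third_deg_zero,
    Subsingleton.elim (x.comp (Ext.mk₀ h.i) (add_zero n)) 0, Ext.zero_comp]

variable {S : ShortComplex C} (hS : S.ShortExact) {X Y : C}

include hS

theorem ext_subsingleton_X₂_left (n : ℕ) [Subsingleton (Ext.{w} S.X₁ Y n)]
    [Subsingleton (Ext.{w} S.X₃ Y n)] : Subsingleton (Ext.{w} S.X₂ Y n) := by
  refine subsingleton_of_forall_eq 0 fun x => ?_
  obtain ⟨y, rfl⟩ := Ext.contravariant_sequence_exact₂ hS Y x (Subsingleton.elim _ _)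
  rw [Subsingleton.elim y 0, Ext.comp_zero]

theorem ext_subsingleton_X₂_right (n : ℕ) [Subsingleton (Ext.{w} X S.X₁ n)]
    [Subsingleton (Ext.{w} X S.X₃ n)] : Subsingleton (Ext.{w} X S.X₂ n) := by
  refine subsingleton_of_forall_eq 0 fun x => ?_
  obtain ⟨y, rfl⟩ := Ext.covariant_sequence_exact₂ X hS x (Subsingleton.elim _ _)
  rw [Subsingleton.elim y 0, Ext.zero_comp]

theorem ext_subsingleton_X₁_left (n : ℕ) [Subsingleton (Ext.{w} S.X₂ Y n)]
    [Subsingleton (Ext.{w} S.X₃ Y (n + 1))] : Subsingleton (Ext.{w} S.X₁ Y n) := by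
  refine subsingleton_of_forall_eq 0 fun x => ?_
  obtain ⟨y, rfl⟩ := Ext.contravariant_sequence_exact₁ hS Y x (add_comm 1 n)
    (Subsingleton.elim _ _)
  rw [Subsingleton.elim y 0, Ext.comp_zero]

theorem ext_subsingleton_X₁_right (n : ℕ) [Subsingleton (Ext.{w} X S.X₂ (n + 1))]
    [Subsingleton (Ext.{w} X S.X₃ n)] : Subsingleton (Ext.{w} X S.X₁ (n + 1)) := by
  refine subsingleton_of_forall_eq 0 fun x => ?_
  obtain ⟨y, rfl⟩ := Ext.covariant_sequence_exact₁ X hS x (Subsingleton.elim _ _) rfl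
  rw [Subsingleton.elim y 0, Ext.zero_comp]

theorem exists_comp_g_eq [Subsingleton (Ext.{w} X S.X₁ 1)] (f : X ⟶ S.X₃) :
    ∃ g : X ⟶ S.X₂, g ≫ S.g = f := by
  obtain ⟨x, hx⟩ := Ext.covariant_sequence_exact₃ X hS (Ext.mk₀ f) (zero_add 1)
    (Subsingleton.elim _ _)
  obtain ⟨g, rfl⟩ := Ext.homEquiv₀.symm.surjective x
  refine ⟨g, Ext.homEquiv₀.symm.injective ?_⟩
  change Ext.mk₀ _ = Ext.mk₀ f
  rwa [← Ext.mk₀_comp_mk₀]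

theorem exists_f_comp_eq [Subsingleton (Ext.{w} S.X₃ Y 1)] (f : S.X₁ ⟶ Y) :
    ∃ g : S.X₂ ⟶ Y, S.f ≫ g = f := by
  obtain ⟨x, hx⟩ := Ext.contravariant_sequence_exact₁ hS Y (Ext.mk₀ f) (add_zero 1)
    (Subsingleton.elim _ _)
  obtain ⟨g, rfl⟩ := Ext.homEquiv₀.symm.surjective x
  refine ⟨g, Ext.homEquiv₀.symm.injective ?_⟩
  change Ext.mk₀ _ = Ext.mk₀ f
  rwa [← Ext.mk₀_comp_mk₀]

theorem ext_subsingleton_iff_forall_exists_comp_g_eq [Injective S.X₂] :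
    Subsingleton (Ext.{w} X S.X₁ 1) ↔ ∀ f : X ⟶ S.X₃, ∃ g : X ⟶ S.X₂, g ≫ S.g = f := by
  refine ⟨fun _ => exists_comp_g_eq hS, fun h => subsingleton_of_forall_eq 0 fun x => ?_⟩
  obtain ⟨y, rfl⟩ := Ext.covariant_sequence_exact₁ X hS x (Ext.eq_zero_of_injective _) (zero_add 1)
  obtain ⟨f, rfl⟩ := Ext.homEquiv₀.symm.surjective y
  obtain ⟨g, rfl⟩ := h f
  change (Ext.mk₀ (g ≫ S.g)).comp hS.extClass _ = 0
  rw [← Ext.mk₀_comp_mk₀, Ext.comp_assoc_of_second_deg_zero, hS.comp_extClass, Ext.comp_zero]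

/- The lifting criterion for `Ext¹` along the sequences `S` and `S.map G` is transported by the
bijection `Hom(F W, -) ≃ Hom(W, G -)`. -/
theorem ext_subsingleton_iff_of_adjunction {D : Type*} [Category.{v} D] [Abelian D]
    [HasExt.{w} D] {F : D ⥤ C} {G : C ⥤ D} [G.PreservesZeroMorphisms] (adj : F ⊣ G)
    (hGS : (S.map G).ShortExact) [Injective S.X₂] [Injective (G.obj S.X₂)] (W : D) :
    Subsingleton (Ext.{w} (F.obj W) S.X₁ 1) ↔ Subsingleton (Ext.{w} W (G.obj S.X₁) 1) := by
  have : Injective (S.map G).X₂ := ‹Injective (G.obj S.X₂)›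
  refine (ext_subsingleton_iff_forall_exists_comp_g_eq hS).trans
    (.trans ?_ (ext_subsingleton_iff_forall_exists_comp_g_eq hGS).symm)
  refine (adj.homEquiv W S.X₃).forall_congr fun f => (adj.homEquiv W S.X₂).exists_congr fun g => ?_
  rw [← (adj.homEquiv W S.X₃).apply_eq_iff_eq, adj.homEquiv_naturality_right]
  rfl

end Ext

section Splice

variable {C : Type*} [Category C] [Abelian C]

/-- `Z` is a cosyzygy of `X`: the cokernel of a monomorphism from `X` to an injective object. -/
def IsCosyzygy (X Z : C) : Prop :=
  ∃ (E : C) (f : X ⟶ E) (g : E ⟶ Z) (w : f ≫ g = 0),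
    Injective E ∧ (ShortComplex.mk f g w).ShortExact

theorem isCosyzygy_of_shortExact {S : ShortComplex C} (hS : S.ShortExact) [Injective S.X₂] :
    IsCosyzygy S.X₁ S.X₃ :=
  ⟨S.X₂, S.f, S.g, S.zero, inferInstance, hS⟩

theorem IsCosyzygy.of_iso {X X' Z Z' : C} (h : IsCosyzygy X Z) (e : X ≅ X') (e' : Z ≅ Z') :
    IsCosyzygy X' Z' := by
  obtain ⟨E, f, g, w, hE, hS⟩ := h
  have w' : (e.inv ≫ f) ≫ g ≫ e'.hom = 0 := by simp [reassoc_of% w]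
  exact ⟨E, e.inv ≫ f, g ≫ e'.hom, w', hE, ShortComplex.shortExact_of_iso
    (ShortComplex.isoMk e (Iso.refl E) e') hS⟩

section Cocycles

variable (I : CochainComplex C ℤ)

/-- The sequence `Zⁿ → Iⁿ → Zⁿ⁺¹` of cocycles of a complex. -/
def cocycleSequence (n : ℤ) : ShortComplex C :=
  .mk (Limits.kernel.ι (I.d n (n + 1)))
    (Limits.kernel.lift (I.d (n + 1) (n + 1 + 1)) (I.d n (n + 1)) (I.d_comp_d _ _ _))
    (by rw [← cancel_mono (Limits.kernel.ι _)]; simp)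

variable {I}

theorem cocycleSequence_shortExact (hI : I.Acyclic) (n : ℤ) :
    (cocycleSequence I n).ShortExact where
  exact := by
    let φ : cocycleSequence I n ⟶
        .mk (Limits.kernel.ι (I.d n (n + 1))) (I.d n (n + 1)) (Limits.kernel.condition _) :=
      { τ₁ := 𝟙 _, τ₂ := 𝟙 _, τ₃ := Limits.kernel.ι _
        comm₁₂ := by simp [cocycleSequence]
        comm₂₃ := by simp [cocycleSequence] }
    have : Epi φ.τ₁ := inferInstanceAs (Epi (𝟙 _))
    have : IsIso φ.τ₂ := inferInstanceAs (IsIso (𝟙 _))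
    have : Mono φ.τ₃ := inferInstanceAs (Mono (Limits.kernel.ι (I.d (n + 1) (n + 1 + 1))))
    exact (ShortComplex.exact_iff_of_epi_of_isIso_of_mono φ).2 (ShortComplex.exact_kernel _)
  mono_f := inferInstanceAs (Mono (Limits.kernel.ι (I.d n (n + 1))))
  epi_g := (ShortComplex.exact_iff_epi_kernel_lift _).1
    ((I.exactAt_iff' n (n + 1) (n + 1 + 1) (by simp) (by simp)).1 (hI (n + 1)))

end Cocycles

section

variable {X E : ℤ → C} {f : ∀ n, X n ⟶ E n} {g : ∀ n, E n ⟶ X (n + 1)} (w : ∀ n, f n ≫ g n = 0)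

/-- The complex obtained by splicing the sequences `Xⁿ → Eⁿ → Xⁿ⁺¹`. -/
def splice : CochainComplex C ℤ :=
  CochainComplex.of E (fun n => g n ≫ f (n + 1)) fun n => by simp [reassoc_of% w]

theorem splice_d (n : ℤ) : (splice w).d n (n + 1) = g n ≫ f (n + 1) :=
  CochainComplex.of_d E (fun n => g n ≫ f (n + 1)) n

variable {w} (hS : ∀ n, (ShortComplex.mk (f n) (g n) (w n)).ShortExact)

include hS

theorem splice_acyclic : (splice w).Acyclic := by
  intro j
  obtain ⟨n, rfl⟩ : ∃ n, j = n + 1 := ⟨j - 1, by ring⟩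
  rw [HomologicalComplex.exactAt_iff' _ n (n + 1) (n + 1 + 1) (by simp) (by simp)]
  let T : ShortComplex C := .mk (g n ≫ f (n + 1)) (g (n + 1)) (by simp [w])
  let φ : T ⟶ .mk (f (n + 1)) (g (n + 1)) (w (n + 1)) := { τ₁ := g n, τ₂ := 𝟙 _, τ₃ := 𝟙 _ }
  let ψ : T ⟶ (splice w).sc' n (n + 1) (n + 1 + 1) :=
    { τ₁ := 𝟙 _, τ₂ := 𝟙 _, τ₃ := f (n + 1 + 1)
      comm₁₂ := (Category.id_comp _).trans ((splice_d w n).trans (Category.comp_id _).symm)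
      comm₂₃ := (Category.id_comp _).trans (splice_d w (n + 1)) }
  have : Epi φ.τ₁ := (hS n).epi_g
  have : IsIso φ.τ₂ := inferInstanceAs (IsIso (𝟙 _))
  have : Mono φ.τ₃ := inferInstanceAs (Mono (𝟙 _))
  have : Epi ψ.τ₁ := inferInstanceAs (Epi (𝟙 _))
  have : IsIso ψ.τ₂ := inferInstanceAs (IsIso (𝟙 _))
  have : Mono ψ.τ₃ := (hS (n + 1 + 1)).mono_f
  rw [← ShortComplex.exact_iff_of_epi_of_isIso_of_mono ψ,
    ShortComplex.exact_iff_of_epi_of_isIso_of_mono φ]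
  exact (hS (n + 1)).exact

/-- The cocycles of the splice of short exact sequences are the objects at which it is spliced. -/
def kernelSpliceIso (n : ℤ) : X n ≅ Limits.kernel ((splice w).d n (n + 1)) :=
  have := (hS (n + 1)).mono_f
  (hS n).fIsKernel.conePointUniqueUpToIso (Limits.kernelIsKernel (g n)) ≪≫
    (Limits.kernelCompMono (g n) (f (n + 1))).symm ≪≫ Limits.kernelIsoOfEq (splice_d w n).symm

end

end Splice

/-! ### Chains of cosyzygies of modules -/

section Gorenstein

open Abelian (Ext)

variable {A : Type u} [Ring A]

theorem homExact_iff (E : ModuleCat.{u} A) (I : CochainComplex (ModuleCat.{u} A) ℤ) :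
    HomExact E I ↔ ∀ n : ℤ, ∀ f : E ⟶ I.X (n + 1), f ≫ I.d (n + 1) (n + 1 + 1) = 0 →
      ∃ g : E ⟶ I.X n, g ≫ I.d n (n + 1) = f := by
  have exactAt_iff (n : ℤ) := (HomologicalComplex.exactAt_iff'
    (((preadditiveCoyoneda.obj (Opposite.op E)).mapHomologicalComplex _).obj I)
    n (n + 1) (n + 1 + 1) (by simp) (by simp)).trans (ShortComplex.ab_exact_iff _)
  refine ⟨fun h n => (exactAt_iff n).1 (h (n + 1)), fun h j => ?_⟩
  obtain ⟨n, rfl⟩ : ∃ n, j = n + 1 := ⟨j - 1, (sub_add_cancel j 1).symm⟩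
  exact (exactAt_iff n).2 (h n)

theorem homExact_iff_ext {I : CochainComplex (ModuleCat.{u} A) ℤ} (hI : I.Acyclic)
    (hinj : ∀ n, Injective (I.X n)) (E : ModuleCat.{u} A) :
    HomExact E I ↔
      ∀ n, Subsingleton (Ext.{u} E (Limits.kernel (I.d n (n + 1))) 1) := by
  rw [homExact_iff]
  refine forall_congr' fun n => ?_
  have : Injective (cocycleSequence I n).X₂ := hinj n
  refine Iff.trans ?_ (ext_subsingleton_iff_forall_exists_comp_g_eq
    (cocycleSequence_shortExact hI n)).symm
  constructor
  · intro h (f : E ⟶ Limits.kernel (I.d (n + 1) (n + 1 + 1)))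
    obtain ⟨g, hg⟩ := h (f ≫ Limits.kernel.ι _) (by simp)
    exact ⟨g, (cancel_mono (Limits.kernel.ι _)).1 (by simpa [cocycleSequence] using hg)⟩
  · intro h f hf
    obtain ⟨(g : E ⟶ I.X n), hg : g ≫ Limits.kernel.lift _ _ (I.d_comp_d _ _ _) = _⟩ :=
      h (Limits.kernel.lift _ f hf)
    exact ⟨g, by simpa using congrArg (· ≫ Limits.kernel.ι _) hg⟩

theorem splice_isCompleteInjectiveResolution {X E : ℤ → ModuleCat.{u} A} {f : ∀ n, X n ⟶ E n}
    {g : ∀ n, E n ⟶ X (n + 1)} {w : ∀ n, f n ≫ g n = 0} (hE : ∀ n, Injective (E n))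
    (hS : ∀ n, (ShortComplex.mk (f n) (g n) (w n)).ShortExact)
    (ext : ∀ (J : ModuleCat.{u} A) (_ : Injective J) (n : ℤ), Subsingleton (Ext.{u} J (X n) 1)) :
    IsCompleteInjectiveResolution (splice w) where
  exact := splice_acyclic hS
  injective := hE
  homExact J hJ := (homExact_iff_ext (splice_acyclic hS) hE J).2 fun n =>
    have := ext J hJ n
    ext_subsingleton_of_retract_right J (.ofIso (kernelSpliceIso hS n).symm) 1

theorem gorensteinInjective_of_int_chain {X : ℤ → ModuleCat.{u} A}
    (step : ∀ n, IsCosyzygy (X n) (X (n + 1)))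
    (ext : ∀ J : ModuleCat.{u} A, Injective J → ∀ n, Subsingleton (Ext.{u} J (X n) 1)) (n : ℤ) :
    gorensteinInjective A (X n) := by
  have step' (k : ℤ) : IsCosyzygy (X (n + k)) (X (n + (k + 1))) := add_assoc n k 1 ▸ step (n + k)
  choose E f g w hE hS using step'
  rw [← add_zero n]
  exact ⟨splice w, splice_isCompleteInjectiveResolution hE hS fun J hJ k => ext J hJ (n + k),
    ⟨kernelSpliceIso hS 0⟩⟩

theorem exists_int_chain {α : Type*} {P : α → Prop} {r : α → α → Prop}
    (succ : ∀ x, P x → ∃ y, P y ∧ r x y) (pred : ∀ x, P x → ∃ y, P y ∧ r y x) {x : α} (hx : P x) :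
    ∃ s : ℤ → α, s 0 = x ∧ (∀ n, P (s n)) ∧ ∀ n, r (s n) (s (n + 1)) := by
  choose f hf hrf using succ
  choose g hg hrg using pred
  let a : ℕ → {x // P x} := fun n => Nat.rec ⟨x, hx⟩ (fun _ y => ⟨f y.1 y.2, hf y.1 y.2⟩) n
  let b : ℕ → {x // P x} := fun n => Nat.rec ⟨x, hx⟩ (fun _ y => ⟨g y.1 y.2, hg y.1 y.2⟩) n
  let s : ℤ → {x // P x} := fun n => Int.casesOn n (fun k => a k) (fun k => b (k + 1))
  refine ⟨fun n => (s n).1, rfl, fun n => (s n).2, fun n => ?_⟩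
  match n with
  | .ofNat k => exact hrf (a k).1 (a k).2
  | .negSucc 0 => exact hrg (b 0).1 (b 0).2
  | .negSucc (k + 1) =>
    rw [show Int.negSucc (k + 1) + 1 = Int.negSucc k by omega]
    exact hrg (b (k + 1)).1 (b (k + 1)).2

theorem gorensteinInjective_of_isCosyzygy {P : ObjectProperty (ModuleCat.{u} A)}
    (succ : ∀ X, P X → ∃ Z, P Z ∧ IsCosyzygy X Z) (pred : ∀ X, P X → ∃ Z, P Z ∧ IsCosyzygy Z X)
    (ext : ∀ J X : ModuleCat.{u} A, Injective J → P X → Subsingleton (Ext.{u} J X 1)) :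
    P ≤ gorensteinInjective A := by
  intro X hX
  obtain ⟨s, rfl, hs, step⟩ := exists_int_chain succ pred hX
  exact gorensteinInjective_of_int_chain step (fun J hJ n => ext J (s n) hJ (hs n)) 0

theorem IsCompleteInjectiveResolution.isCosyzygy_kernel {I : CochainComplex (ModuleCat.{u} A) ℤ}
    (hI : IsCompleteInjectiveResolution I) (n : ℤ) :
    IsCosyzygy (Limits.kernel (I.d n (n + 1))) (Limits.kernel (I.d (n + 1) (n + 1 + 1))) :=
  ⟨_, _, _, _, hI.injective n, cocycleSequence_shortExact hI.exact n⟩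

theorem IsCompleteInjectiveResolution.gorensteinInjective_kernel
    {I : CochainComplex (ModuleCat.{u} A) ℤ} (hI : IsCompleteInjectiveResolution I) (n : ℤ) :
    gorensteinInjective A (Limits.kernel (I.d n (n + 1))) :=
  gorensteinInjective_of_int_chain hI.isCosyzygy_kernel
    (fun J hJ => (homExact_iff_ext hI.exact hI.injective J).1 (hI.homExact J hJ)) n

instance : (gorensteinInjective A).IsClosedUnderIsomorphisms where
  of_iso := by
    rintro X Y e ⟨I, hI, ⟨i⟩⟩
    exact ⟨I, hI, ⟨e.symm ≪≫ i⟩⟩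

theorem gorensteinInjective.exists_cosyzygy {X : ModuleCat.{u} A} (h : gorensteinInjective A X) :
    ∃ Z, gorensteinInjective A Z ∧ IsCosyzygy X Z := by
  obtain ⟨I, hI, ⟨i⟩⟩ := h
  exact ⟨_, hI.gorensteinInjective_kernel (0 + 1),
    (hI.isCosyzygy_kernel 0).of_iso i.symm (Iso.refl _)⟩

theorem gorensteinInjective.exists_syzygy {X : ModuleCat.{u} A} (h : gorensteinInjective A X) :
    ∃ Z, gorensteinInjective A Z ∧ IsCosyzygy Z X := by
  obtain ⟨I, hI, ⟨i⟩⟩ := h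
  exact ⟨_, hI.gorensteinInjective_kernel (-1),
    (hI.isCosyzygy_kernel (-1)).of_iso (Iso.refl _) i.symm⟩

end Gorenstein

/-! ### Tensor powers and modules of homomorphisms -/

namespace TensorRing

variable (R : Type u) [Ring R]
variable (M : Type u) [AddCommGroup M] [Module R M] [Module Rᵐᵒᵖ M] [SMulCommClass R Rᵐᵒᵖ M]

theorem gen_mul_of (m : M) (i : ℕ) (x : TPow R M i) :
    gen R M m * of R M i x = of R M (i + 1) (TPow.cons R M i m x) := by
  rw [gen_mul, shift_of]

theorem of_mul_incl (i : ℕ) (x : TPow R M i) (r : R) :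
    of R M i x * incl R M r = of R M i (op r • x) := by
  induction i with
  | zero =>
    obtain ⟨s, rfl⟩ := (TPow.scalar R M).surjective x
    rw [← incl_apply, ← map_mul, incl_apply, TPow.op_smul_scalar]
  | succ i ih =>
    refine TPow.succ_induction x ?_ (fun m y => ?_) (fun y z hy hz => ?_)
    · rw [smul_zero, map_zero, zero_mul]
    · rw [← gen_mul_of, mul_assoc, ih, gen_mul_of, TPow.op_smul_cons]
    · rw [smul_add, map_add, map_add, add_mul, hy, hz]

variable {R M} in
@[elab_as_elim]
theorem gen_induction {p : TensorRing R M → Prop} (t : TensorRing R M)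
    (incl : ∀ r, p (incl R M r)) (gen_mul : ∀ m s, p s → p (gen R M m * s))
    (add : ∀ s t, p s → p t → p (s + t)) : p t := by
  have zero : p 0 := map_zero (TensorRing.incl R M) ▸ incl 0
  refine induction_on t zero (fun i x => ?_) add
  induction i with
  | zero => exact incl ((TPow.scalar R M).symm x)
  | succ i ih =>
    refine TPow.succ_induction x (by rwa [map_zero]) (fun m y => ?_) (fun y z hy hz => ?_)
    · exact gen_mul_of R M m i y ▸ gen_mul m _ (ih y)
    · exact map_add (of R M (i + 1)) y z ▸ add _ _ hy hz

/-- The projection of the tensor ring onto its component of degree `0`. -/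
def projZero : TensorRing R M →+ R :=
  toAdd R M fun i => match i with
    | 0 => (TPow.scalar R M).symm.toAddMonoidHom
    | _ + 1 => 0

theorem projZero_incl (r : R) : projZero R M (incl R M r) = r :=
  toAdd_of R M _ 0 (TPow.scalar R M r)

theorem projZero_of_succ (i : ℕ) (x : TPow R M (i + 1)) : projZero R M (of R M (i + 1) x) = 0 :=
  toAdd_of R M _ (i + 1) x

theorem projZero_incl_mul (r : R) (t : TensorRing R M) :
    projZero R M (incl R M r * t) = r * projZero R M t := by
  refine induction_on t ?_ (fun i x => ?_) (fun x y hx hy => ?_)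
  · rw [mul_zero, map_zero, mul_zero]
  · rw [incl_mul, smul_of]
    cases i with
    | zero => exact projZero_incl R M (r * _) |>.trans (congrArg (r * ·) (projZero_incl R M _).symm)
    | succ i => rw [projZero_of_succ, projZero_of_succ, mul_zero]
  · rw [mul_add, map_add, map_add, mul_add, hx, hy]

theorem projZero_gen_mul (m : M) (t : TensorRing R M) : projZero R M (gen R M m * t) = 0 := by
  refine induction_on t ?_ (fun i x => ?_) (fun x y hx hy => ?_)
  · rw [mul_zero, map_zero]
  · rw [gen_mul_of, projZero_of_succ]
  · rw [mul_add, map_add, hx, hy, add_zero]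

/-- The augmentation `T_R(M) → R`, the retraction of `R → T_R(M)` that annihilates `M`. -/
def augmentation : TensorRing R M →+* R where
  __ := projZero R M
  map_one' := projZero_incl R M 1
  map_mul' s t := by
    change projZero R M (s * t) = projZero R M s * projZero R M t
    refine gen_induction s (fun r => ?_) (fun m s _ => ?_) (fun s s' hs hs' => ?_)
    · rw [projZero_incl_mul, projZero_incl]
    · rw [mul_assoc, projZero_gen_mul, projZero_gen_mul, zero_mul]
    · rw [add_mul, map_add, map_add, add_mul, hs, hs']

theorem augmentation_incl (r : R) : augmentation R M (incl R M r) = r := projZero_incl R M r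

theorem augmentation_gen_mul (m : M) (t : TensorRing R M) :
    augmentation R M (gen R M m * t) = 0 :=
  projZero_gen_mul R M m t

theorem augmentation_gen (m : M) : augmentation R M (gen R M m) = 0 := projZero_of_succ R M 0 _

end TensorRing

namespace RHom

variable (R : Type u) [Ring R]

section Map

variable (X : Type u) [AddCommGroup X] [Module Rᵐᵒᵖ X] [Module R X] [SMulCommClass R Rᵐᵒᵖ X]
variable {Y Y' : Type u} [AddCommGroup Y] [Module Rᵐᵒᵖ Y] [AddCommGroup Y'] [Module Rᵐᵒᵖ Y']

/-- The map `Hom_{R^op}(X, f)` on modules of homomorphisms. -/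
def map (f : Y →ₗ[Rᵐᵒᵖ] Y') : RHom R X Y →ₗ[Rᵐᵒᵖ] RHom R X Y' where
  toFun g := (equiv R X Y').symm (f.comp (equiv R X Y g))
  map_add' g h := ext fun x => map_add f (equiv R X Y g x) (equiv R X Y h x)
  map_smul' _ _ := rfl

theorem map_apply (f : Y →ₗ[Rᵐᵒᵖ] Y') (g : RHom R X Y) (x : X) :
    equiv R X Y' (map R X f g) x = f (equiv R X Y g x) := rfl

theorem map_injective {f : Y →ₗ[Rᵐᵒᵖ] Y'} (hf : Function.Injective f) :
    Function.Injective (map R X f) := fun _ _ h =>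
  ext fun x => hf (congrArg (fun g => equiv R X Y' g x) h)

theorem map_exact {Y'' : Type u} [AddCommGroup Y''] [Module Rᵐᵒᵖ Y''] {f : Y →ₗ[Rᵐᵒᵖ] Y'}
    {g : Y' →ₗ[Rᵐᵒᵖ] Y''} (hf : Function.Injective f) (hfg : Function.Exact f g) :
    Function.Exact (map R X f) (map R X g) := by
  refine fun h => ⟨fun h0 => ?_, ?_⟩
  · have h_range (x : X) : equiv R X Y' h x ∈ LinearMap.range f :=
      (hfg _).1 (congrArg (fun k => equiv R X Y'' k x) h0)
    refine ⟨(equiv R X Y).symm ((LinearEquiv.ofInjective f hf).symm.toLinearMap ∘ₗ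
      (equiv R X Y' h).codRestrict _ h_range), ext fun x => ?_⟩
    exact congrArg Subtype.val ((LinearEquiv.ofInjective f hf).apply_symm_apply ⟨_, h_range x⟩)
  · rintro ⟨k, rfl⟩
    exact ext fun x => hfg.apply_apply_eq_zero _

/-- The isomorphism `Hom_{R^op}(X, e)` of modules of homomorphisms. -/
def mapEquiv (e : Y ≃ₗ[Rᵐᵒᵖ] Y') : RHom R X Y ≃ₗ[Rᵐᵒᵖ] RHom R X Y' where
  __ := map R X e.toLinearMap
  invFun := map R X e.symm.toLinearMap
  left_inv f := ext fun x => e.symm_apply_apply (equiv R X Y f x)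
  right_inv f := ext fun x => e.apply_symm_apply (equiv R X Y' f x)

end Map

section Curry

variable (M : Type u) [AddCommGroup M] [Module R M] [Module Rᵐᵒᵖ M] [SMulCommClass R Rᵐᵒᵖ M]
variable (Y : Type u) [AddCommGroup Y] [Module Rᵐᵒᵖ Y]

/-- Evaluation at `1`, as an isomorphism `Hom_{R^op}(M^{⊗ 0}, Y) ≅ Y`. -/
def evalOne : RHom R (TPow R M 0) Y ≃ₗ[Rᵐᵒᵖ] Y where
  toFun f := equiv R (TPow R M 0) Y f (TPow.scalar R M 1)
  map_add' _ _ := rfl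
  map_smul' r f := by
    rw [smul_apply, TPow.smul_scalar, mul_one, RingHom.id_apply, ← map_smul, ← op_unop r,
      TPow.op_smul_scalar, one_mul, unop_op]
  invFun y := (equiv R (TPow R M 0) Y).symm
    { toFun := fun x => op ((TPow.scalar R M).symm x) • y
      map_add' := fun x x' => by rw [map_add, MulOpposite.op_add, add_smul]
      map_smul' := fun r x => mul_smul r (op ((TPow.scalar R M).symm x)) y }
  left_inv f := ext fun x => by
    obtain ⟨s, rfl⟩ := (TPow.scalar R M).surjective x
    change op s • equiv R (TPow R M 0) Y f (TPow.scalar R M 1) = _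
    rw [← map_smul, TPow.op_smul_scalar, one_mul]
  right_inv y := one_smul Rᵐᵒᵖ y

/-- The homomorphism `m ⊗ x ↦ f m x`. -/
def uncurry (i : ℕ) (f : RHom R M (RHom R (TPow R M i) Y)) : RHom R (TPow R M (i + 1)) Y :=
  let φ : TPow R M (i + 1) →+ Y := TPow.succLift R M i
    { toFun := fun m => (equiv R (TPow R M i) Y (equiv R M _ f m)).toAddMonoidHom
      map_zero' := by rw [map_zero, map_zero]; rfl
      map_add' := fun m m' => by rw [map_add, map_add]; rfl }
    (fun r m x => congrArg (fun g => equiv R (TPow R M i) Y g x)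
      (map_smul (equiv R M _ f) (op r) m))
  (equiv R (TPow R M (i + 1)) Y).symm
    { φ with
      map_smul' := fun r x => by
        change φ (r • x) = r • φ x
        refine TPow.succ_induction x ?_ (fun m y => ?_) (fun y z hy hz => ?_)
        · rw [smul_zero, map_zero, smul_zero]
        · rw [TPow.op_smul_cons]
          exact map_smul (equiv R (TPow R M i) Y (equiv R M _ f m)) r y
        · rw [smul_add, map_add, map_add, smul_add, hy, hz] }

variable {R M Y} in
theorem succ_ext {i : ℕ} {f g : RHom R (TPow R M (i + 1)) Y}
    (h : ∀ m x, equiv R (TPow R M (i + 1)) Y f (TPow.cons R M i m x) =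
      equiv R (TPow R M (i + 1)) Y g (TPow.cons R M i m x)) : f = g :=
  ext fun x => by
    refine TPow.succ_induction x ?_ h (fun y z hy hz => ?_)
    · rw [map_zero, map_zero]
    · rw [map_add, map_add, hy, hz]

/-- The adjunction isomorphism
`Hom_{R^op}(M ⊗_R M^{⊗ i}, Y) ≅ Hom_{R^op}(M, Hom_{R^op}(M^{⊗ i}, Y))`. -/
def curry (i : ℕ) : RHom R (TPow R M (i + 1)) Y ≃ₗ[Rᵐᵒᵖ] RHom R M (RHom R (TPow R M i) Y) where
  toFun f := (equiv R M _).symm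
    { toFun := fun m => (equiv R (TPow R M i) Y).symm
        { (equiv R (TPow R M (i + 1)) Y f).toAddMonoidHom.comp (TPow.cons R M i m) with
          map_smul' := fun r x =>
            map_smul (equiv R (TPow R M (i + 1)) Y f) r (TPow.cons R M i m x) }
      map_add' := fun m m' => ext fun x => by
        change equiv R (TPow R M (i + 1)) Y f (TPow.cons R M i (m + m') x) =
          equiv R (TPow R M (i + 1)) Y f (TPow.cons R M i m x) +
          equiv R (TPow R M (i + 1)) Y f (TPow.cons R M i m' x)
        rw [map_add, AddMonoidHom.add_apply, map_add]
      map_smul' := fun r m => ext fun x =>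
        congrArg (equiv R (TPow R M (i + 1)) Y f) (TPow.cons_op_smul R M i (unop r) m x) }
  map_add' _ _ := rfl
  map_smul' _ _ := rfl
  invFun := uncurry R M Y i
  left_inv _ := succ_ext fun _ _ => rfl
  right_inv _ := rfl

theorem curry_apply (i : ℕ) (f : RHom R (TPow R M (i + 1)) Y) (m : M) (x : TPow R M i) :
    equiv R (TPow R M i) Y (equiv R M _ (curry R M Y i f) m) x =
      equiv R (TPow R M (i + 1)) Y f (TPow.cons R M i m x) := rfl

/-- The adjunction isomorphism
`Hom_{R^op}(M^{⊗ i} ⊗_R M, Y) ≅ Hom_{R^op}(M^{⊗ i}, Hom_{R^op}(M, Y))`, with `M^{⊗ (i + 1)}`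
in place of `M^{⊗ i} ⊗_R M`. -/
def snocCurry : ∀ i : ℕ, RHom R (TPow R M (i + 1)) Y ≃ₗ[Rᵐᵒᵖ] RHom R (TPow R M i) (RHom R M Y)
  | 0 => curry R M Y 0 ≪≫ₗ mapEquiv R M (evalOne R M Y) ≪≫ₗ (evalOne R M (RHom R M Y)).symm
  | i + 1 => curry R M Y (i + 1) ≪≫ₗ mapEquiv R M (snocCurry i) ≪≫ₗ (curry R M (RHom R M Y) i).symm

theorem snocCurry_zero_scalar (f : RHom R (TPow R M 1) Y) (r : R) (m : M) :
    equiv R M Y (equiv R (TPow R M 0) _ (snocCurry R M Y 0 f) (TPow.scalar R M r)) m =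
      equiv R (TPow R M 1) Y f (TPow.cons R M 0 (r • m) (TPow.scalar R M 1)) := rfl

theorem snocCurry_succ_cons (i : ℕ) (f : RHom R (TPow R M (i + 2)) Y) (m : M)
    (x : TPow R M i) :
    equiv R (TPow R M (i + 1)) _ (snocCurry R M Y (i + 1) f) (TPow.cons R M i m x) =
      equiv R (TPow R M i) _ (snocCurry R M Y i (equiv R M _ (curry R M Y (i + 1) f) m)) x := rfl

end Curry

end RHom

/-! ### The kernel of the structure map -/

section ModuleCat

variable {A B : Type u} [Ring A] [Ring B]

theorem shortExact_of_function_exact {S : ShortComplex (ModuleCat.{u} A)}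
    (hf : Function.Injective S.f) (hfg : Function.Exact S.f S.g) (hg : Function.Surjective S.g) :
    S.ShortExact where
  exact := (ShortComplex.ShortExact.moduleCat_exact_iff_function_exact S).2 hfg
  mono_f := (ModuleCat.mono_iff_injective _).2 hf
  epi_g := (ModuleCat.epi_iff_surjective _).2 hg

theorem shortExact_function_exact {S : ShortComplex (ModuleCat.{u} A)} (hS : S.ShortExact) :
    Function.Exact S.f S.g :=
  (ShortComplex.ShortExact.moduleCat_exact_iff_function_exact S).1 hS.exact

theorem shortExact_map_restrictScalars (f : A →+* B) {S : ShortComplex (ModuleCat.{u} B)}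
    (hS : S.ShortExact) : (S.map (ModuleCat.restrictScalars f)).ShortExact :=
  shortExact_of_function_exact hS.moduleCat_injective_f
    (show Function.Exact S.f S.g from shortExact_function_exact hS) hS.moduleCat_surjective_g

end ModuleCat

section StructureMap

variable {R : Type u} [Ring R]
variable {M : Type u} [AddCommGroup M] [Module R M] [Module Rᵐᵒᵖ M] [SMulCommClass R Rᵐᵒᵖ M]

theorem RHom.map_surjective_of_ext (X : Type u) [AddCommGroup X] [Module R X] [Module Rᵐᵒᵖ X]
    [SMulCommClass R Rᵐᵒᵖ X] {S : ShortComplex (ModuleCat.{u} Rᵐᵒᵖ)} (hS : S.ShortExact)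
    [Subsingleton (Abelian.Ext.{u} (ModuleCat.of Rᵐᵒᵖ X) S.X₁ 1)] :
    Function.Surjective (RHom.map R X S.g.hom) := by
  intro φ
  obtain ⟨g, hg⟩ := exists_comp_g_eq hS (ModuleCat.ofHom (RHom.equiv R X S.X₃ φ))
  exact ⟨(RHom.equiv R X S.X₂).symm g.hom, RHom.ext fun x => congrArg (fun f => f.hom x) hg⟩

/-- The identification of a right `T_R(M)`-module with its underlying right `R`-module. -/
def res (Y : ModuleCat.{u} (TensorRing R M)ᵐᵒᵖ) : Y ≃+ (forgetful R M).obj Y := AddEquiv.refl _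

theorem structureMap_res (Y : ModuleCat.{u} (TensorRing R M)ᵐᵒᵖ) (y : Y) (m : M) :
    RHom.equiv R M _ (structureMap Y (res Y y)) m = res Y (op (TensorRing.gen R M m) • y) := rfl

variable {Y Z : ModuleCat.{u} (TensorRing R M)ᵐᵒᵖ}

theorem structureMap_res_eq_zero_iff (y : Y) :
    structureMap Y (res Y y) = 0 ↔ ∀ m : M, op (TensorRing.gen R M m) • y = 0 :=
  ⟨fun h m => (res Y).injective (congrArg (fun f => RHom.equiv R M _ f m) h),
    fun h => RHom.ext fun m => congrArg (res Y) (h m)⟩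

theorem op_smul_of_structureMap_eq_zero {y : Y} (hy : structureMap Y (res Y y) = 0)
    (t : TensorRing R M) :
    op t • y = op (TensorRing.incl R M (TensorRing.augmentation R M t)) • y := by
  refine TensorRing.gen_induction t (fun r => ?_) (fun m s _ => ?_) (fun s t hs ht => ?_)
  · rw [TensorRing.augmentation_incl]
  · rw [op_mul, mul_smul, (structureMap_res_eq_zero_iff y).1 hy, smul_zero,
      TensorRing.augmentation_gen_mul, map_zero, MulOpposite.op_zero, zero_smul]
  · rw [map_add, map_add, MulOpposite.op_add, MulOpposite.op_add, add_smul, add_smul, hs, ht]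

theorem structureMap_map (f : Y ⟶ Z) (y : (forgetful R M).obj Y) :
    structureMap Z ((forgetful R M).map f y) =
      RHom.map R M ((forgetful R M).map f).hom (structureMap Y y) :=
  RHom.ext fun m => (f.hom.map_smul (op (TensorRing.gen R M m)) ((res Y).symm y)).symm

theorem structureMap_surjective_of_map {g : Y ⟶ Z} (hY : Function.Surjective (structureMap Y))
    (hg : Function.Surjective (RHom.map R M ((forgetful R M).map g).hom)) :
    Function.Surjective (structureMap Z) := by
  intro φ
  obtain ⟨y, rfl⟩ := (hg.comp hY) φ
  exact ⟨_, structureMap_map g y⟩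

variable (R M) in
/-- The functor `[Y, v] ↦ ker v`. -/
def kerStructureMap : ModuleCat.{u} (TensorRing R M)ᵐᵒᵖ ⥤ ModuleCat.{u} Rᵐᵒᵖ where
  obj Y := ModuleCat.of Rᵐᵒᵖ (LinearMap.ker (structureMap Y))
  map {Y Z} f := ModuleCat.ofHom <|
    ((forgetful R M).map f).hom.restrict fun y (hy : structureMap Y y = 0) =>
      (structureMap_map f y).trans ((congrArg (RHom.map R M _) hy).trans (map_zero _))

variable (R M) in
/-- The functor `X ↦ [X, 0]`. -/
abbrev triv : ModuleCat.{u} Rᵐᵒᵖ ⥤ ModuleCat.{u} (TensorRing R M)ᵐᵒᵖ :=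
  ModuleCat.restrictScalars (TensorRing.augmentation R M).op

variable (R M) in
/-- The identification of `X` with the underlying group of `[X, 0]`. -/
def toTriv (X : ModuleCat.{u} Rᵐᵒᵖ) : X ≃+ (triv R M).obj X := AddEquiv.refl _

theorem op_smul_toTriv (X : ModuleCat.{u} Rᵐᵒᵖ) (t : TensorRing R M) (x : X) :
    op t • toTriv R M X x = toTriv R M X (op (TensorRing.augmentation R M t) • x) := rfl

/-- The maps `[X, 0] → [Y, v]` are the `R`-linear maps `X → ker v`. -/
def trivHomEquiv (X : ModuleCat.{u} Rᵐᵒᵖ) (Y : ModuleCat.{u} (TensorRing R M)ᵐᵒᵖ) :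
    ((triv R M).obj X ⟶ Y) ≃ (X ⟶ (kerStructureMap R M).obj Y) where
  toFun f := ModuleCat.ofHom
    { toFun := fun x => ⟨res Y (f.hom (toTriv R M X x)),
        (structureMap_res_eq_zero_iff _).2 fun m => by
          rw [← map_smul, op_smul_toTriv, TensorRing.augmentation_gen, MulOpposite.op_zero,
            zero_smul, map_zero, map_zero]⟩
      map_add' := fun x x' => Subtype.ext (f.hom.map_add x x')
      map_smul' := fun r x => Subtype.ext <| (res Y).symm.injective <| by
        change f.hom (toTriv R M X (r • x)) =
          op (TensorRing.incl R M (unop r)) • f.hom (toTriv R M X x)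
        rw [← map_smul, op_smul_toTriv, TensorRing.augmentation_incl, op_unop] }
  invFun g := ModuleCat.ofHom (X := (triv R M).obj X)
    { toFun := fun x => (res Y).symm (g.hom x).1
      map_add' := fun x x' => congrArg Subtype.val (g.hom.map_add x x')
      map_smul' := fun t x =>
        (congrArg Subtype.val (g.hom.map_smul (op (TensorRing.augmentation R M (unop t))) x)).trans
          (op_smul_of_structureMap_eq_zero (g.hom x).2 (unop t)).symm }
  left_inv _ := rfl
  right_inv _ := rfl

variable (R M) in
/-- The kernel of the structure map is the largest submodule on which `M` acts by zero. -/
def trivKerAdjunction : triv R M ⊣ kerStructureMap R M :=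
  Adjunction.mkOfHomEquiv
    { homEquiv := trivHomEquiv
      homEquiv_naturality_left_symm := fun _ _ => rfl
      homEquiv_naturality_right := fun _ _ => rfl }

instance : (kerStructureMap R M).IsRightAdjoint := (trivKerAdjunction R M).isRightAdjoint

instance (I : ModuleCat.{u} (TensorRing R M)ᵐᵒᵖ) [Injective I] :
    Injective ((kerStructureMap R M).obj I) :=
  Injective.injective_of_adjoint (trivKerAdjunction R M) I

section ShortExact

variable {S : ShortComplex (ModuleCat.{u} (TensorRing R M)ᵐᵒᵖ)} (hS : S.ShortExact)

include hS

theorem kerStructureMap_shortExact_iff : (S.map (kerStructureMap R M)).ShortExact ↔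
    Function.Surjective ((kerStructureMap R M).map S.g) := by
  refine ⟨fun h => h.moduleCat_surjective_g, fun h =>
    { exact := hS.exact.map_of_mono_of_preservesKernel _ hS.mono_f inferInstance
      mono_f := ?_
      epi_g := (ModuleCat.epi_iff_surjective _).2 h }⟩
  have := hS.mono_f
  exact inferInstanceAs (Mono ((kerStructureMap R M).map S.f))

theorem forgetful_map_exact : Function.Exact ((forgetful R M).map S.f).hom
    ((forgetful R M).map S.g).hom := shortExact_function_exact hS

theorem kerStructureMap_shortExact (h₁ : Function.Surjective (structureMap S.X₁)) :
    (S.map (kerStructureMap R M)).ShortExact := by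
  have hf : Function.Injective ((forgetful R M).map S.f).hom := hS.moduleCat_injective_f
  have hg : Function.Surjective ((forgetful R M).map S.g).hom := hS.moduleCat_surjective_g
  refine (kerStructureMap_shortExact_iff hS).2 fun ⟨w, (hw : structureMap S.X₃ w = 0)⟩ => ?_
  obtain ⟨z, rfl⟩ := hg w
  obtain ⟨φ, hφ⟩ := (RHom.map_exact R M hf (forgetful_map_exact hS) (structureMap S.X₂ z)).1
    ((structureMap_map S.g z).symm.trans hw)
  obtain ⟨y, rfl⟩ := h₁ φ
  refine ⟨⟨z - ((forgetful R M).map S.f).hom y, ?_⟩, Subtype.ext ?_⟩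
  · exact LinearMap.sub_mem_ker_iff.2 (hφ.symm.trans (structureMap_map S.f y).symm)
  · change ((forgetful R M).map S.g).hom (z - ((forgetful R M).map S.f).hom y) = _
    rw [map_sub, (forgetful_map_exact hS).apply_apply_eq_zero, sub_zero]

theorem structureMap_X₁_surjective (h₂ : Function.Surjective (structureMap S.X₂))
    (hK : (S.map (kerStructureMap R M)).ShortExact) : Function.Surjective (structureMap S.X₁) := by
  have hf : Function.Injective ((forgetful R M).map S.f).hom := hS.moduleCat_injective_f
  intro φ
  obtain ⟨z, hz⟩ := h₂ (RHom.map R M ((forgetful R M).map S.f).hom φ)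
  have hgz : structureMap S.X₃ (((forgetful R M).map S.g).hom z) = 0 := by
    rw [structureMap_map, hz]
    exact (RHom.map_exact R M hf (forgetful_map_exact hS)).apply_apply_eq_zero φ
  obtain ⟨⟨s, hs : structureMap S.X₂ s = 0⟩, hsz⟩ := hK.moduleCat_surjective_g ⟨_, hgz⟩
  have hsz : ((forgetful R M).map S.g).hom s = ((forgetful R M).map S.g).hom z :=
    congrArg Subtype.val hsz
  obtain ⟨y, hy⟩ := (forgetful_map_exact hS (z - s)).1 (by rw [map_sub, hsz, sub_self])
  refine ⟨y, RHom.map_injective R M hf ?_⟩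
  rw [← structureMap_map, hy, map_sub, hs, sub_zero, hz]

end ShortExact

end StructureMap

/-! ### Coinduced modules -/

namespace coind

variable {R : Type u} [Ring R]
variable {M : Type u} [AddCommGroup M] [Module R M] [Module Rᵐᵒᵖ M] [SMulCommClass R Rᵐᵒᵖ M]
variable {E : ModuleCat.{u} Rᵐᵒᵖ}

/-- The value at `t` of an element of `Hom_{R^op}(T_R(M), E)`. -/
def eval (j : (coind R M).obj E) : TensorRing R M →+ E where
  toFun t := ModuleCat.CoextendScalars.equiv _ E j (op t : (TensorRing R M)ᵐᵒᵖ)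
  map_zero' := map_zero (ModuleCat.CoextendScalars.equiv _ E j)
  map_add' s t := map_add (ModuleCat.CoextendScalars.equiv _ E j) (op s : (TensorRing R M)ᵐᵒᵖ)
    (op t : (TensorRing R M)ᵐᵒᵖ)

theorem eval_mul_incl (j : (coind R M).obj E) (t : TensorRing R M) (r : R) :
    eval j (t * TensorRing.incl R M r) = op r • eval j t :=
  (ModuleCat.CoextendScalars.equiv _ E j).map_smul (op r) (op t : (TensorRing R M)ᵐᵒᵖ)

theorem eval_smul (j : (coind R M).obj E) (s t : TensorRing R M) :
    eval (op s • j) t = eval j (s * t) := rfl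

theorem ext {j k : (coind R M).obj E} (h : ∀ t, eval j t = eval k t) : j = k :=
  ModuleCat.CoextendScalars.ext (LinearMap.ext fun t => h (unop t))

section Components

variable (E)

/-- The restriction map `Hom_{R^op}(T_R(M), E) → Hom_{R^op}(M^{⊗ i}, E)`. -/
def component (i : ℕ) :
    (forgetful R M).obj ((coind R M).obj E) →ₗ[Rᵐᵒᵖ] RHom R (TPow R M i) E where
  toFun j := (RHom.equiv R (TPow R M i) E).symm
    { toFun := fun x => eval ((res _).symm j) (TensorRing.of R M i x)
      map_add' := fun x y => by rw [map_add, map_add]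
      map_smul' := fun r x => by
        obtain ⟨r, rfl⟩ := op_surjective r
        rw [← TensorRing.of_mul_incl, eval_mul_incl, RingHom.id_apply] }
  map_add' _ _ := rfl
  map_smul' r j := RHom.ext fun x => congrArg (eval ((res _).symm j))
    ((TensorRing.incl_mul R M (unop r) _).trans (TensorRing.smul_of R M _ i x))

variable {E} in
theorem component_res (j : (coind R M).obj E) (i : ℕ) (x : TPow R M i) :
    RHom.equiv R (TPow R M i) E (component E i (res _ j)) x = eval j (TensorRing.of R M i x) := rfl

variable {E} in
theorem component_ext {j k : (forgetful R M).obj ((coind R M).obj E)}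
    (h : ∀ i, component E i j = component E i k) : j = k := by
  refine (res _).symm.injective (ext fun t => TensorRing.induction_on t ?_ (fun i x => ?_) ?_)
  · rw [map_zero, map_zero]
  · exact congrArg (fun f => RHom.equiv R (TPow R M i) E f x) (h i)
  · intro s t hs ht
    rw [map_add, map_add, hs, ht]

theorem exists_component_eq (f : ∀ i, RHom R (TPow R M i) E) :
    ∃ j, ∀ i, component E i j = f i := by
  let φ : TensorRing R M →+ E :=
    TensorRing.toAdd R M fun i => (RHom.equiv R (TPow R M i) E (f i)).toAddMonoidHom
  have φ_of (i : ℕ) (x : TPow R M i) :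
      φ (TensorRing.of R M i x) = RHom.equiv R (TPow R M i) E (f i) x :=
    TensorRing.toAdd_of R M _ i x
  have φ_mul_incl (t : TensorRing R M) (r : R) : φ (t * TensorRing.incl R M r) = op r • φ t := by
    refine TensorRing.induction_on t ?_ (fun i x => ?_) (fun s t hs ht => ?_)
    · rw [zero_mul, map_zero, smul_zero]
    · rw [TensorRing.of_mul_incl, φ_of, φ_of, map_smul]
    · rw [add_mul, map_add, map_add, smul_add, hs, ht]
  exact ⟨res _ ((ModuleCat.CoextendScalars.equiv _ E).symm
    { toFun := fun t => φ (unop (t : (TensorRing R M)ᵐᵒᵖ))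
      map_add' := fun s t => map_add φ (unop (s : (TensorRing R M)ᵐᵒᵖ))
        (unop (t : (TensorRing R M)ᵐᵒᵖ))
      map_smul' := fun r t => φ_mul_incl (unop (t : (TensorRing R M)ᵐᵒᵖ)) (unop r) }),
    fun i => RHom.ext fun x => φ_of i x⟩

/-- `Hom_{R^op}(T_R(M), E)` is the product of the modules `Hom_{R^op}(M^{⊗ i}, E)`. -/
def componentsEquiv :
    (forgetful R M).obj ((coind R M).obj E) ≃ₗ[Rᵐᵒᵖ] ∀ i, RHom R (TPow R M i) E :=
  LinearEquiv.ofBijective (LinearMap.pi (component E))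
    ⟨fun _ _ h => component_ext fun i => congrFun h i,
      fun f => (exists_component_eq E f).imp fun _ h => funext h⟩

theorem component_componentsEquiv_symm (f : ∀ i, RHom R (TPow R M i) E) (i : ℕ) :
    component E i ((componentsEquiv E).symm f) = f i :=
  congrFun ((componentsEquiv E).apply_symm_apply f) i

theorem curry_component_succ (i : ℕ) (j : (forgetful R M).obj ((coind R M).obj E)) :
    RHom.curry R M E i (component E (i + 1) j) =
      RHom.map R M (component E i) (structureMap ((coind R M).obj E) j) :=
  RHom.ext fun m => RHom.ext fun x =>
    congrArg (eval ((res _).symm j)) (TensorRing.gen_mul_of R M m i x).symm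

theorem snocCurry_component_succ_apply (i : ℕ) (j : (coind R M).obj E) (x : TPow R M i) (m : M) :
    RHom.equiv R M E (RHom.equiv R (TPow R M i) _
      (RHom.snocCurry R M E i (component E (i + 1) (res _ j))) x) m =
        eval j (TensorRing.of R M i x * TensorRing.gen R M m) := by
  induction i generalizing j with
  | zero =>
    obtain ⟨r, rfl⟩ := (TPow.scalar R M).surjective x
    rw [RHom.snocCurry_zero_scalar, component_res, ← TensorRing.incl_apply, ← TensorRing.gen_smul]
    rfl
  | succ i ih =>
    refine TPow.succ_induction x ?_ (fun m' y => ?_) (fun y z hy hz => ?_)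
    · rw [map_zero, map_zero, map_zero, zero_mul, map_zero]
      rfl
    · rw [RHom.snocCurry_succ_cons, curry_component_succ, RHom.map_apply, structureMap_res, ih,
        eval_smul, ← mul_assoc, TensorRing.gen_mul_of]
    · rw [map_add, map_add, map_add, add_mul, map_add, ← hy, ← hz]
      rfl

theorem map_component_ext {f g : RHom R M ((forgetful R M).obj ((coind R M).obj E))}
    (h : ∀ i, RHom.map R M (component E i) f = RHom.map R M (component E i) g) : f = g :=
  RHom.ext fun m => component_ext fun i => congrArg (fun k => RHom.equiv R M _ k m) (h i)

/-- The `R`-linear section of the structure map of a coinduced module with vanishing component of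
degree `0`. -/
def structureMapSection : RHom R M ((forgetful R M).obj ((coind R M).obj E)) →ₗ[Rᵐᵒᵖ]
    (forgetful R M).obj ((coind R M).obj E) :=
  (componentsEquiv E).symm.toLinearMap ∘ₗ LinearMap.pi fun i => match i with
    | 0 => 0
    | i + 1 => (RHom.curry R M E i).symm.toLinearMap ∘ₗ RHom.map R M (component E i)

theorem structureMap_structureMapSection
    (φ : RHom R M ((forgetful R M).obj ((coind R M).obj E))) :
    structureMap ((coind R M).obj E) (structureMapSection E φ) = φ :=
  map_component_ext E fun i => by
    rw [← curry_component_succ]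
    exact (congrArg (RHom.curry R M E i) (component_componentsEquiv_symm E _ (i + 1))).trans
      ((RHom.curry R M E i).apply_symm_apply _)

theorem structureMap_surjective : Function.Surjective (structureMap ((coind R M).obj E)) :=
  fun φ => ⟨_, structureMap_structureMapSection E φ⟩

variable {E} in
theorem structureMap_eq_zero_iff {j : (forgetful R M).obj ((coind R M).obj E)} :
    structureMap ((coind R M).obj E) j = 0 ↔ ∀ i, component E (i + 1) j = 0 := by
  refine ⟨fun h i => (RHom.curry R M E i).injective ?_, fun h => map_component_ext E fun i => ?_⟩
  · rw [curry_component_succ, h, map_zero, map_zero]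
  · rw [← curry_component_succ, h, map_zero, map_zero]

/-- Evaluation at `1` identifies the kernel of the structure map of `Coind(E)` with `E`. -/
def kerStructureMapEquiv : (kerStructureMap R M).obj ((coind R M).obj E) ≃ₗ[Rᵐᵒᵖ] E :=
  LinearEquiv.ofBijective
    ((RHom.evalOne R M E).toLinearMap ∘ₗ component E 0 ∘ₗ Submodule.subtype _) <| by
  constructor
  · intro j k h
    have h₀ : component E 0 j.1 = component E 0 k.1 := (RHom.evalOne R M E).injective h
    refine Subtype.ext (component_ext fun i => ?_)
    cases i with
    | zero => exact h₀
    | succ i => rw [structureMap_eq_zero_iff.1 j.2, structureMap_eq_zero_iff.1 k.2]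
  · intro e
    have h (i : ℕ) := component_componentsEquiv_symm E
      (Pi.single (M := fun i => RHom R (TPow R M i) E) 0 ((RHom.evalOne R M E).symm e)) i
    exact ⟨⟨_, structureMap_eq_zero_iff.2 fun i => h (i + 1)⟩,
      (congrArg (RHom.evalOne R M E) (h 0)).trans ((RHom.evalOne R M E).apply_symm_apply e)⟩

end Components

section Sequence

/-- The map of `T_R(M)`-modules `Y → Coind(E)` that corresponds to an `R`-linear map `Y → E`. -/
def lift {Y : ModuleCat.{u} (TensorRing R M)ᵐᵒᵖ} (f : (forgetful R M).obj Y ⟶ E) :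
    Y ⟶ (coind R M).obj E :=
  (ModuleCat.restrictCoextendScalarsAdj (TensorRing.incl R M).op).homEquiv Y E f

theorem eval_lift {Y : ModuleCat.{u} (TensorRing R M)ᵐᵒᵖ} (f : (forgetful R M).obj Y ⟶ E)
    (y : Y) (t : TensorRing R M) : eval (lift f y) t = f (res Y (op t • y)) := rfl

instance [Injective E] : Injective ((coind R M).obj E) :=
  Injective.injective_of_adjoint
    (ModuleCat.restrictCoextendScalarsAdj.{u} (TensorRing.incl R M).op) E

variable (R M E)

/-- The embedding `[E, 0] → Coind(E)` of the kernel of the structure map. -/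
def fromTriv : (triv R M).obj E ⟶ (coind R M).obj E :=
  (trivHomEquiv E _).symm (kerStructureMapEquiv E).symm.toModuleIso.hom

/-- The map `Coind(E) → Coind(Hom_{R^op}(M, E))` given by `j ↦ t ↦ m ↦ j(t m)`. -/
def toCoindRHom : (coind R M).obj E ⟶ (coind R M).obj (ModuleCat.of Rᵐᵒᵖ (RHom R M E)) :=
  lift (ModuleCat.ofHom (X := (forgetful R M).obj ((coind R M).obj E))
    ((RHom.mapEquiv R M (RHom.evalOne R M E)).toLinearMap ∘ₗ
      (RHom.curry R M E 0).toLinearMap ∘ₗ component E 1))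

theorem eval_toCoindRHom (j : (coind R M).obj E) (t : TensorRing R M) (m : M) :
    RHom.equiv R M E (eval (toCoindRHom R M E j) t) m = eval j (t * TensorRing.gen R M m) := rfl

variable {R M} in
theorem component_toCoindRHom (i : ℕ) (j : (coind R M).obj E) :
    component (ModuleCat.of Rᵐᵒᵖ (RHom R M E)) i (res _ (toCoindRHom R M E j)) =
      RHom.snocCurry R M E i (component E (i + 1) (res _ j)) :=
  RHom.ext fun x => RHom.ext fun m =>
    (eval_toCoindRHom R M E j _ m).trans (snocCurry_component_succ_apply E i j x m).symm

theorem toCoindRHom_surjective : Function.Surjective (toCoindRHom R M E) := by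
  intro k
  obtain ⟨j, hj⟩ := exists_component_eq E fun i => match i with
    | 0 => 0
    | i + 1 => (RHom.snocCurry R M E i).symm (component _ i (res _ k))
  refine ⟨(res _).symm j, (res _).injective (component_ext fun i => ?_)⟩
  rw [component_toCoindRHom, AddEquiv.apply_symm_apply, hj]
  exact (RHom.snocCurry R M E i).apply_symm_apply _

variable {R M E} in
theorem toCoindRHom_eq_zero_iff {j : (coind R M).obj E} :
    toCoindRHom R M E j = 0 ↔ structureMap _ (res _ j) = 0 := by
  rw [structureMap_eq_zero_iff]
  refine ⟨fun h i => (RHom.snocCurry R M E i).injective ?_,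
    fun h => (res _).injective (component_ext fun i => ?_)⟩
  · rw [← component_toCoindRHom, h, map_zero, map_zero, map_zero]
  · rw [component_toCoindRHom, h, map_zero, map_zero, map_zero]

theorem fromTriv_toCoindRHom_exact : Function.Exact (fromTriv R M E) (toCoindRHom R M E) := by
  intro j
  rw [toCoindRHom_eq_zero_iff]
  constructor
  · intro h
    exact ⟨toTriv R M E (kerStructureMapEquiv E ⟨res _ j, h⟩),
      congrArg Subtype.val ((kerStructureMapEquiv E).symm_apply_apply ⟨res _ j, h⟩)⟩
  · rintro ⟨e, rfl⟩
    exact ((kerStructureMapEquiv E).symm ((toTriv R M E).symm e)).2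

/-- The sequence `[E, 0] → Coind(E) → Coind(Hom_{R^op}(M, E))`. -/
def coindSequence : ShortComplex (ModuleCat.{u} (TensorRing R M)ᵐᵒᵖ) :=
  .mk (fromTriv R M E) (toCoindRHom R M E)
    (ModuleCat.hom_ext (LinearMap.ext (fromTriv_toCoindRHom_exact R M E).apply_apply_eq_zero))

theorem coindSequence_shortExact : (coindSequence R M E).ShortExact :=
  shortExact_of_function_exact
    (Subtype.val_injective.comp (kerStructureMapEquiv E).symm.injective)
    (fromTriv_toCoindRHom_exact R M E) (toCoindRHom_surjective R M E)

end Sequence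

end coind

/-! ### The action of the tensor powers -/

section RHomKernel

variable {R : Type u} [Ring R] (X : Type u) [AddCommGroup X] [Module Rᵐᵒᵖ X] [Module R X]
  [SMulCommClass R Rᵐᵒᵖ X]
variable {A B : Type u} [AddCommGroup A] [Module Rᵐᵒᵖ A] [AddCommGroup B] [Module Rᵐᵒᵖ B]

theorem RHom.map_eq_zero_iff {f : A →ₗ[Rᵐᵒᵖ] B} {φ : RHom R X A} :
    RHom.map R X f φ = 0 ↔ ∃ ψ, RHom.map R X (Submodule.subtype (LinearMap.ker f)) ψ = φ :=
  RHom.map_exact R X Subtype.val_injective (LinearMap.exact_subtype_ker_map f) φ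

/-- `Hom_{R^op}(X, -)` commutes with kernels. -/
def RHom.kerMapEquiv (f : A →ₗ[Rᵐᵒᵖ] B) :
    LinearMap.ker (RHom.map R X f) ≃ₗ[Rᵐᵒᵖ] RHom R X (LinearMap.ker f) :=
  (LinearEquiv.ofEq _ _ (Submodule.ext fun _ => RHom.map_eq_zero_iff X)).trans
    (LinearEquiv.ofInjective _ (RHom.map_injective R X Subtype.val_injective)).symm

end RHomKernel

section KernelSequence

variable {A : Type u} [Ring A] {V₁ V₂ V₃ : Type u} [AddCommGroup V₁] [Module A V₁]
  [AddCommGroup V₂] [Module A V₂] [AddCommGroup V₃] [Module A V₃]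

/-- The sequence `0 → ker f → V₁ → V₂ → 0` of a surjective map. -/
def kerSequence (f : V₁ →ₗ[A] V₂) : ShortComplex (ModuleCat.{u} A) :=
  .mk (ModuleCat.ofHom (LinearMap.ker f).subtype) (ModuleCat.ofHom f)
    (ModuleCat.hom_ext (LinearMap.ext fun x => x.2))

theorem kerSequence_shortExact {f : V₁ →ₗ[A] V₂} (hf : Function.Surjective f) :
    (kerSequence f).ShortExact :=
  shortExact_of_function_exact (S := kerSequence f) Subtype.val_injective
    (LinearMap.exact_subtype_ker_map f) hf

/-- The sequence `0 → ker f → ker (g ∘ f) → ker g → 0` of composable maps with `f` surjective. -/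
def kerCompSequence (f : V₁ →ₗ[A] V₂) (g : V₂ →ₗ[A] V₃) : ShortComplex (ModuleCat.{u} A) :=
  .mk (ModuleCat.ofHom (Submodule.inclusion (LinearMap.ker_le_ker_comp f g)))
    (ModuleCat.ofHom (f.restrict (p := LinearMap.ker (g ∘ₗ f)) (q := LinearMap.ker g)
      fun _ hx => hx))
    (ModuleCat.hom_ext (LinearMap.ext fun x => Subtype.ext x.2))

theorem kerCompSequence_shortExact {f : V₁ →ₗ[A] V₂} (hf : Function.Surjective f)
    (g : V₂ →ₗ[A] V₃) : (kerCompSequence f g).ShortExact := by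
  refine shortExact_of_function_exact (S := kerCompSequence f g)
    (Submodule.inclusion_injective (LinearMap.ker_le_ker_comp f g)) (fun x => ?_)
    (fun ⟨y, hy⟩ => ?_)
  · exact ⟨fun hx => ⟨⟨x.1, congrArg Subtype.val hx⟩, rfl⟩,
      fun ⟨y, hy⟩ => hy ▸ Subtype.ext y.2⟩
  · obtain ⟨x, rfl⟩ := hf y
    exact ⟨⟨x, hy⟩, rfl⟩

end KernelSequence

section ActionMap

variable {R : Type u} [Ring R]
variable {M : Type u} [AddCommGroup M] [Module R M] [Module Rᵐᵒᵖ M] [SMulCommClass R Rᵐᵒᵖ M]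

/-- The map `Y → Hom_{R^op}(M^{⊗ k}, Y)`, `y ↦ (x ↦ y x)`; for `k = 1` it is the structure map. -/
def actionMap (Y : ModuleCat.{u} (TensorRing R M)ᵐᵒᵖ) (k : ℕ) :
    (forgetful R M).obj Y →ₗ[Rᵐᵒᵖ] RHom R (TPow R M k) ((forgetful R M).obj Y) :=
  coind.component _ k ∘ₗ ((forgetful R M).map (coind.lift (𝟙 ((forgetful R M).obj Y)))).hom

variable (Y : ModuleCat.{u} (TensorRing R M)ᵐᵒᵖ) (k : ℕ)

theorem actionMap_res (y : Y) (x : TPow R M k) :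
    RHom.equiv R (TPow R M k) _ (actionMap Y k (res Y y)) x =
      res Y (op (TensorRing.of R M k x) • y) := rfl

theorem curry_actionMap_succ (y : (forgetful R M).obj Y) :
    RHom.curry R M _ k (actionMap Y (k + 1) y) =
      RHom.map R M (actionMap Y k) (structureMap Y y) := by
  obtain ⟨y, rfl⟩ := (res Y).surjective y
  refine RHom.ext fun m => RHom.ext fun x => ?_
  rw [RHom.curry_apply, RHom.map_apply, structureMap_res, actionMap_res, actionMap_res,
    ← TensorRing.gen_mul_of, op_mul, mul_smul]

theorem snocCurry_actionMap_succ (y : (forgetful R M).obj Y) :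
    RHom.snocCurry R M _ k (actionMap Y (k + 1) y) =
      RHom.map R (TPow R M k) (structureMap Y) (actionMap Y k y) := by
  obtain ⟨y, rfl⟩ := (res Y).surjective y
  refine RHom.ext fun x => RHom.ext fun m => ?_
  rw [RHom.map_apply, actionMap_res, structureMap_res, ← mul_smul, ← op_mul]
  exact coind.snocCurry_component_succ_apply _ k (coind.lift (𝟙 _) y) x m

variable {Y k}

theorem actionMap_map {Z : ModuleCat.{u} (TensorRing R M)ᵐᵒᵖ} (f : Y ⟶ Z) (k : ℕ)
    (y : (forgetful R M).obj Y) : actionMap Z k ((forgetful R M).map f y) =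
      RHom.map R (TPow R M k) ((forgetful R M).map f).hom (actionMap Y k y) :=
  RHom.ext fun x => (f.hom.map_smul (op (TensorRing.of R M k x)) ((res Y).symm y)).symm

theorem evalOne_actionMap_zero (y : (forgetful R M).obj Y) :
    RHom.evalOne R M _ (actionMap Y 0 y) = y :=
  one_smul (TensorRing R M)ᵐᵒᵖ ((res Y).symm y)

theorem actionMap_zero_bijective : Function.Bijective (actionMap Y 0) := by
  refine ((RHom.evalOne R M _).bijective.of_comp_iff' _).1 ?_
  exact (funext evalOne_actionMap_zero : RHom.evalOne R M _ ∘ actionMap Y 0 = id) ▸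
    Function.bijective_id

theorem actionMap_succ_eq_zero_iff {y : (forgetful R M).obj Y} : actionMap Y (k + 1) y = 0 ↔
    RHom.map R (TPow R M k) (structureMap Y) (actionMap Y k y) = 0 := by
  rw [← snocCurry_actionMap_succ, LinearEquiv.map_eq_zero_iff]

theorem actionMap_eq_zero_of_nilpotent {N : ℕ} (hN : IsNilpotentBimodule R M N) :
    actionMap Y (N + 1) = 0 := by
  have : Subsingleton (TPow R M (N + 1)) := hN
  exact LinearMap.ext fun y => RHom.ext fun x => by
    rw [Subsingleton.elim x 0, map_zero, map_zero]

theorem actionMap_induction {N : ℕ} (hN : IsNilpotentBimodule R M N)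
    {p : (forgetful R M).obj Y → Prop} (zero : p 0)
    (succ : ∀ k, (∀ y, actionMap Y k y = 0 → p y) → ∀ y, actionMap Y (k + 1) y = 0 → p y)
    (y : (forgetful R M).obj Y) : p y := by
  have h (k : ℕ) : ∀ y, actionMap Y k y = 0 → p y := by
    induction k with
    | zero =>
      intro y hy
      rwa [actionMap_zero_bijective.1 (hy.trans (map_zero _).symm)]
    | succ k ih => exact succ k ih
  exact h (N + 1) y (congrArg (fun f => f y) (actionMap_eq_zero_of_nilpotent hN))

theorem exists_actionMap_section (s : RHom R M ((forgetful R M).obj Y) →ₗ[Rᵐᵒᵖ]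
    (forgetful R M).obj Y) (hs : ∀ φ, structureMap Y (s φ) = φ) (k : ℕ) :
    ∃ σ : RHom R (TPow R M k) ((forgetful R M).obj Y) →ₗ[Rᵐᵒᵖ] (forgetful R M).obj Y,
      ∀ φ, actionMap Y k (σ φ) = φ := by
  induction k with
  | zero => exact ⟨(RHom.evalOne R M _).toLinearMap, fun φ =>
      (RHom.evalOne R M _).injective (evalOne_actionMap_zero _)⟩
  | succ k ih =>
    obtain ⟨σ, hσ⟩ := ih
    let e := RHom.curry R M ((forgetful R M).obj Y) k
    refine ⟨s ∘ₗ RHom.map R M σ ∘ₗ e.toLinearMap, fun φ =>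
      e.injective ((curry_actionMap_succ Y k _).trans ?_)⟩
    refine (congrArg (RHom.map R M (actionMap Y k)) (hs (RHom.map R M σ (e φ)))).trans ?_
    exact RHom.ext fun m => hσ (RHom.equiv R M _ (e φ) m)

theorem coind.actionMap_surjective (E : ModuleCat.{u} Rᵐᵒᵖ) (k : ℕ) :
    Function.Surjective (actionMap ((coind R M).obj E) k) := by
  obtain ⟨σ, hσ⟩ := exists_actionMap_section (coind.structureMapSection (M := M) E)
    (coind.structureMap_structureMapSection E) k
  exact fun φ => ⟨σ φ, hσ φ⟩

section Nilpotent

variable {Z : ModuleCat.{u} (TensorRing R M)ᵐᵒᵖ} {N : ℕ} (hN : IsNilpotentBimodule R M N)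
  {f : Y ⟶ Z}

include hN

theorem injective_of_kerStructureMap_injective
    (hf : Function.Injective ((kerStructureMap R M).map f)) :
    Function.Injective ((forgetful R M).map f).hom := by
  refine (injective_iff_map_eq_zero _).2 fun y => ?_
  refine actionMap_induction hN (p := fun y => ((forgetful R M).map f).hom y = 0 → y = 0)
    (fun _ => rfl) (fun k ih y hy hfy => ih y ?_ hfy) y
  obtain ⟨θ, hθ⟩ := (RHom.map_eq_zero_iff _).1 (actionMap_succ_eq_zero_iff.1 hy)
  have hfθ : RHom.map R (TPow R M k) ((kerStructureMap R M).map f).hom θ = 0 := by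
    refine RHom.map_injective R (TPow R M k) (Submodule.subtype_injective _) ?_
    refine Eq.trans ?_ (map_zero _).symm
    refine (congrArg (RHom.map R (TPow R M k) ((forgetful R M).map f).hom) hθ).trans ?_
    exact (actionMap_map f k y).symm.trans ((congrArg (actionMap Z k) hfy).trans (map_zero _))
  have hθ₀ : θ = 0 := RHom.map_injective R (TPow R M k) hf (hfθ.trans (map_zero _).symm)
  exact hθ.symm.trans ((congrArg (RHom.map R (TPow R M k) (Submodule.subtype _)) hθ₀).trans
    (map_zero _))

theorem surjective_of_kerStructureMap_surjective
    (hY : ∀ k, Function.Surjective (actionMap Y k))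
    (hf : ∀ k, Function.Surjective
      (RHom.map R (TPow R M k) ((kerStructureMap R M).map f).hom)) :
    Function.Surjective ((forgetful R M).map f).hom := by
  refine actionMap_induction hN ⟨0, map_zero _⟩ fun k ih z hz => ?_
  obtain ⟨θ, hθ⟩ := (RHom.map_eq_zero_iff _).1 (actionMap_succ_eq_zero_iff.1 hz)
  obtain ⟨η, rfl⟩ := hf k θ
  obtain ⟨y, hy⟩ := hY k (RHom.map R (TPow R M k) (LinearMap.ker (structureMap Y)).subtype η)
  obtain ⟨y', hy'⟩ := ih (z - ((forgetful R M).map f).hom y) <| by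
    rw [map_sub, sub_eq_zero, ← hθ]
    refine Eq.trans ?_ (actionMap_map f k y).symm
    exact (congrArg (RHom.map R (TPow R M k) ((forgetful R M).map f).hom) hy).symm
  exact ⟨y' + y, by rw [map_add, hy', sub_add_cancel]⟩

end Nilpotent

section Ext

open Abelian (Ext)

theorem ker_actionMap_succ : LinearMap.ker (actionMap Y (k + 1)) =
    LinearMap.ker (RHom.map R (TPow R M k) (structureMap Y) ∘ₗ actionMap Y k) :=
  Submodule.ext fun _ => actionMap_succ_eq_zero_iff

theorem actionMap_succ_surjective (hv : Function.Surjective (structureMap Y))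
    (hk : Function.Surjective (actionMap Y k))
    [Subsingleton (Ext.{u} (ModuleCat.of Rᵐᵒᵖ M)
      (ModuleCat.of Rᵐᵒᵖ (LinearMap.ker (actionMap Y k))) 1)] :
    Function.Surjective (actionMap Y (k + 1)) := by
  intro φ
  have : Subsingleton (Ext.{u} (ModuleCat.of Rᵐᵒᵖ M) (kerSequence (actionMap Y k)).X₁ 1) := ‹_›
  obtain ⟨ψ, hψ⟩ := RHom.map_surjective_of_ext M (kerSequence_shortExact hk) (RHom.curry R M _ k φ)
  obtain ⟨y, rfl⟩ := hv ψ
  exact ⟨y, (RHom.curry R M _ k).injective ((curry_actionMap_succ Y k y).trans hψ)⟩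

theorem ext_ker_actionMap_succ_subsingleton (hk : Function.Surjective (actionMap Y k))
    (W : ModuleCat.{u} Rᵐᵒᵖ)
    [Subsingleton (Ext.{u} W (ModuleCat.of Rᵐᵒᵖ (LinearMap.ker (actionMap Y k))) 1)]
    [Subsingleton (Ext.{u} W (ModuleCat.of Rᵐᵒᵖ
      (RHom R (TPow R M k) ((kerStructureMap R M).obj Y))) 1)] :
    Subsingleton (Ext.{u} W (ModuleCat.of Rᵐᵒᵖ (LinearMap.ker (actionMap Y (k + 1)))) 1) := by
  let S := kerCompSequence (actionMap Y k) (RHom.map R (TPow R M k) (structureMap Y))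
  have : Subsingleton (Ext.{u} W S.X₁ 1) := ‹_›
  have : Subsingleton (Ext.{u} W (ModuleCat.of Rᵐᵒᵖ
      (RHom R (TPow R M k) (LinearMap.ker (structureMap Y)))) 1) := ‹_›
  have : Subsingleton (Ext.{u} W S.X₃ 1) := ext_subsingleton_of_retract_right W
    (.ofIso (RHom.kerMapEquiv (TPow R M k) (structureMap Y)).toModuleIso) 1
  rw [ker_actionMap_succ]
  exact ext_subsingleton_X₂_right (kerCompSequence_shortExact hk _) 1

theorem ext_forgetful_subsingleton {N : ℕ} (hN : IsNilpotentBimodule R M N)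
    (hv : Function.Surjective (structureMap Y))
    (ext : ∀ i, Subsingleton (Ext.{u} (ModuleCat.of Rᵐᵒᵖ M)
      (ModuleCat.of Rᵐᵒᵖ (RHom R (TPow R M i) ((kerStructureMap R M).obj Y))) 1)) :
    Subsingleton (Ext.{u} (ModuleCat.of Rᵐᵒᵖ M) ((forgetful R M).obj Y) 1) := by
  have h (k : ℕ) : Function.Surjective (actionMap Y k) ∧ Subsingleton (Ext.{u}
      (ModuleCat.of Rᵐᵒᵖ M) (ModuleCat.of Rᵐᵒᵖ (LinearMap.ker (actionMap Y k))) 1) := by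
    induction k with
    | zero =>
      refine ⟨actionMap_zero_bijective.2, ?_⟩
      have : Subsingleton (LinearMap.ker (actionMap Y 0)) :=
        (Submodule.subsingleton_iff_eq_bot.2 (LinearMap.ker_eq_bot.2 actionMap_zero_bijective.1))
      have := (ModuleCat.isZero_of_subsingleton
        (ModuleCat.of Rᵐᵒᵖ (LinearMap.ker (actionMap Y 0)))).injective
      exact subsingleton_of_forall_eq 0 Ext.eq_zero_of_injective
    | succ k ih =>
      obtain ⟨hk, _⟩ := ih
      exact ⟨actionMap_succ_surjective hv hk, ext_ker_actionMap_succ_subsingleton hk _⟩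
  have htop : LinearMap.ker (actionMap Y (N + 1)) = ⊤ :=
    LinearMap.ker_eq_top.2 (actionMap_eq_zero_of_nilpotent hN)
  have := (h (N + 1)).2
  exact ext_subsingleton_of_retract_right _
    (.ofIso (LinearEquiv.ofTop _ htop).symm.toModuleIso) 1

end Ext

end ActionMap

/-! ### Gorenstein injective modules and the class `Ψ` -/

section Forward

open Abelian (Ext)

variable {R : Type u} [Ring R]
variable {M : Type u} [AddCommGroup M] [Module R M] [Module Rᵐᵒᵖ M] [SMulCommClass R Rᵐᵒᵖ M]
variable {Y Z : ModuleCat.{u} (TensorRing R M)ᵐᵒᵖ}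

theorem coind.lift_injective {E : ModuleCat.{u} Rᵐᵒᵖ} {f : (forgetful R M).obj Y ⟶ E}
    (hf : Function.Injective f) : Function.Injective (coind.lift f) := fun x y h =>
  (res Y).injective (hf (by simpa [coind.eval_lift] using congrArg (coind.eval · 1) h))

variable (R M) in
theorem exists_retract_coind (I : ModuleCat.{u} (TensorRing R M)ᵐᵒᵖ) [Injective I] :
    ∃ E : ModuleCat.{u} Rᵐᵒᵖ, Injective E ∧ Nonempty (Retract I ((coind R M).obj E)) := by
  let ι := Injective.ι ((forgetful R M).obj I)
  have : Mono (coind.lift ι) := (ModuleCat.mono_iff_injective _).2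
    (coind.lift_injective ((ModuleCat.mono_iff_injective ι).1 inferInstance))
  exact ⟨_, inferInstance,
    ⟨⟨coind.lift ι, Injective.factorThru (𝟙 I) (coind.lift ι), Injective.comp_factorThru _ _⟩⟩⟩

theorem structureMap_surjective_of_retract (h : Retract Y Z)
    (hZ : Function.Surjective (structureMap Z)) : Function.Surjective (structureMap Y) :=
  structureMap_surjective_of_map hZ fun φ =>
    ⟨RHom.map R M ((forgetful R M).map h.i).hom φ, RHom.ext fun m =>
      congrArg (fun f => f.hom (RHom.equiv R M _ φ m)) h.retract⟩

theorem structureMap_surjective_of_injective (I : ModuleCat.{u} (TensorRing R M)ᵐᵒᵖ)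
    [Injective I] : Function.Surjective (structureMap I) := by
  obtain ⟨E, -, ⟨h⟩⟩ := exists_retract_coind R M I
  exact structureMap_surjective_of_retract h (coind.structureMap_surjective E)

instance (𝒴 : ObjectProperty (ModuleCat.{u} Rᵐᵒᵖ)) [𝒴.IsClosedUnderIsomorphisms] :
    (Psi R M 𝒴).IsClosedUnderIsomorphisms where
  of_iso e h := ⟨structureMap_surjective_of_retract (.ofIso e.symm) h.1,
    𝒴.prop_of_iso ((kerStructureMap R M).mapIso e) h.2⟩

theorem ext_triv_subsingleton_iff (hv : Function.Surjective (structureMap Y))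
    (W : ModuleCat.{u} Rᵐᵒᵖ) : Subsingleton (Ext.{u} ((triv R M).obj W) Y 1) ↔
      Subsingleton (Ext.{u} W ((kerStructureMap R M).obj Y) 1) := by
  let S : ShortComplex (ModuleCat.{u} (TensorRing R M)ᵐᵒᵖ) :=
    .mk (Injective.ι Y) (Limits.cokernel.π _) (Limits.cokernel.condition _)
  have hS : S.ShortExact := { exact := ShortComplex.exact_cokernel _ }
  have : Injective S.X₂ := inferInstanceAs (Injective (Injective.under Y))
  exact ext_subsingleton_iff_of_adjunction hS (trivKerAdjunction R M)
    (kerStructureMap_shortExact hS hv) W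

section CompleteResolution

variable {I : CochainComplex (ModuleCat.{u} (TensorRing R M)ᵐᵒᵖ) ℤ}
  (hI : IsCompleteInjectiveResolution I)

include hI

theorem structureMap_kernel_surjective
    (hM : HomExact (ModuleCat.of Rᵐᵒᵖ M) (((forgetful R M).mapHomologicalComplex _).obj I))
    (n : ℤ) : Function.Surjective (structureMap (Limits.kernel (I.d n (n + 1)))) := by
  obtain ⟨n, rfl⟩ : ∃ k, n = k + 1 := ⟨n - 1, (sub_add_cancel n 1).symm⟩
  have := hI.injective n
  let ι := Limits.kernel.ι (I.d (n + 1) (n + 1 + 1))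
  have hιd : ι ≫ I.d (n + 1) (n + 1 + 1) = 0 := Limits.kernel.condition _
  refine structureMap_surjective_of_map (g := (cocycleSequence I n).g)
    (structureMap_surjective_of_injective (I.X n)) fun φ => ?_
  obtain ⟨g, hg⟩ := (homExact_iff _ _).1 hM n
    (ModuleCat.ofHom (RHom.equiv R M _ φ) ≫ (forgetful R M).map ι) <| by
      refine (Category.assoc _ _ _).trans ?_
      exact (congrArg (_ ≫ (forgetful R M).map ·) hιd).trans Limits.comp_zero
  refine ⟨(RHom.equiv R M _).symm g.hom, RHom.ext fun m => ?_⟩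
  have hι : Function.Injective ι := (ModuleCat.mono_iff_injective ι).1 inferInstance
  refine hι (Eq.trans ?_ (congrArg (fun f => f.hom m) hg))
  exact congrArg (fun f => f.hom (g.hom m))
    (Limits.kernel.lift_ι (I.d (n + 1) (n + 1 + 1)) (I.d n (n + 1)) _)

theorem ext_triv_kernel_subsingleton {E : ModuleCat.{u} Rᵐᵒᵖ} [Injective E]
    (hE : HomExact ((coind R M).obj (ModuleCat.of Rᵐᵒᵖ (RHom R M E))) I) (n : ℤ) :
    Subsingleton (Ext.{u} ((triv R M).obj E) (Limits.kernel (I.d n (n + 1))) 1) := by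
  have ext₁ {X} (h : HomExact X I) := (homExact_iff_ext hI.exact hI.injective X).1 h
  let S := coind.coindSequence R M E
  have : Subsingleton (Ext.{u} S.X₂ (Limits.kernel (I.d n (n + 1))) 1) :=
    ext₁ (hI.homExact ((coind R M).obj E) inferInstance) n
  have : Injective (cocycleSequence I n).X₂ := hI.injective n
  have : Subsingleton (Ext.{u} S.X₃ (cocycleSequence I n).X₂ (1 + 1)) :=
    subsingleton_of_forall_eq 0 Ext.eq_zero_of_injective
  have : Subsingleton (Ext.{u} S.X₃ (cocycleSequence I n).X₃ 1) := ext₁ hE (n + 1)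
  have : Subsingleton (Ext.{u} S.X₃ (Limits.kernel (I.d n (n + 1))) (1 + 1)) :=
    ext_subsingleton_X₁_right (cocycleSequence_shortExact hI.exact n) 1
  exact ext_subsingleton_X₁_left (coind.coindSequence_shortExact R M E) 1

theorem gorensteinInjective_kerStructureMap_kernel (hcomp : IsCoCompatible R M M) (n : ℤ) :
    gorensteinInjective Rᵐᵒᵖ ((kerStructureMap R M).obj (Limits.kernel (I.d n (n + 1)))) := by
  have hv := structureMap_kernel_surjective hI (hcomp.exact_hom I hI)
  have step (n : ℤ) : IsCosyzygy ((kerStructureMap R M).obj (Limits.kernel (I.d n (n + 1))))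
      ((kerStructureMap R M).obj (Limits.kernel (I.d (n + 1) (n + 1 + 1)))) := by
    have := hI.injective n
    have : Injective ((cocycleSequence I n).map (kerStructureMap R M)).X₂ :=
      inferInstanceAs (Injective ((kerStructureMap R M).obj (I.X n)))
    exact isCosyzygy_of_shortExact
      (kerStructureMap_shortExact (cocycleSequence_shortExact hI.exact n) (hv n))
  exact gorensteinInjective_of_int_chain step (fun E hE n =>
    (ext_triv_subsingleton_iff (hv n) E).1
      (ext_triv_kernel_subsingleton hI (hcomp.exact_hom_coind I hI E hE) n)) n

end CompleteResolution

theorem gorensteinInjective_le_Psi (hcomp : IsCoCompatible R M M) :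
    gorensteinInjective (TensorRing R M)ᵐᵒᵖ ≤ Psi R M (gorensteinInjective Rᵐᵒᵖ) := by
  rintro Y ⟨I, hI, ⟨e⟩⟩
  exact ObjectProperty.prop_of_iso _ e.symm
    ⟨structureMap_kernel_surjective hI (hcomp.exact_hom I hI) 0,
      gorensteinInjective_kerStructureMap_kernel hI hcomp 0⟩

end Forward

section Backward

open Abelian (Ext)

variable {R : Type u} [Ring R]
variable {M : Type u} [AddCommGroup M] [Module R M] [Module Rᵐᵒᵖ M] [SMulCommClass R Rᵐᵒᵖ M]
variable {Y : ModuleCat.{u} (TensorRing R M)ᵐᵒᵖ} {E : ModuleCat.{u} Rᵐᵒᵖ} {N : ℕ}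

theorem RHom.map_TPow_surjective_of_ext {S : ShortComplex (ModuleCat.{u} Rᵐᵒᵖ)} (hS : S.ShortExact)
    (ext : ∀ i, Subsingleton (Ext.{u} (ModuleCat.of Rᵐᵒᵖ M)
      (ModuleCat.of Rᵐᵒᵖ (RHom R (TPow R M i) S.X₁)) 1)) (i : ℕ) :
    Function.Surjective (RHom.map R (TPow R M i) S.g.hom) := by
  induction i with
  | zero =>
    intro φ
    obtain ⟨x, hx⟩ := hS.moduleCat_surjective_g (RHom.evalOne R M S.X₃ φ)
    exact ⟨(RHom.evalOne R M S.X₂).symm x, (RHom.evalOne R M S.X₃).injective <|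
      (congrArg S.g ((RHom.evalOne R M S.X₂).apply_symm_apply x)).trans hx⟩
  | succ i ih =>
    have hf : Function.Injective S.f.hom := hS.moduleCat_injective_f
    let T : ShortComplex (ModuleCat.{u} Rᵐᵒᵖ) :=
      .mk (ModuleCat.ofHom (RHom.map R (TPow R M i) S.f.hom))
        (ModuleCat.ofHom (RHom.map R (TPow R M i) S.g.hom)) <| ModuleCat.hom_ext <| LinearMap.ext
          (RHom.map_exact R _ hf (shortExact_function_exact hS)).apply_apply_eq_zero
    have hT : T.ShortExact := shortExact_of_function_exact
      (RHom.map_injective R _ hf) (RHom.map_exact R _ hf (shortExact_function_exact hS)) ih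
    have : Subsingleton (Ext.{u} (ModuleCat.of Rᵐᵒᵖ M) T.X₁ 1) := ext i
    intro φ
    obtain ⟨ψ, hψ⟩ := RHom.map_surjective_of_ext M hT (RHom.curry R M S.X₃ i φ)
    refine ⟨(RHom.curry R M S.X₂ i).symm ψ, (RHom.curry R M S.X₃ i).injective (Eq.trans ?_ hψ)⟩
    exact congrArg (RHom.map R M (RHom.map R (TPow R M i) S.g.hom))
      ((RHom.curry R M S.X₂ i).apply_symm_apply ψ)

theorem exists_mono_coind (hN : IsNilpotentBimodule R M N) [Injective E]
    (f : (kerStructureMap R M).obj Y ⟶ E) [Mono f] : ∃ φ : Y ⟶ (coind R M).obj E, Mono φ ∧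
      (kerStructureMap R M).map φ ≫ (coind.kerStructureMapEquiv E).toModuleIso.hom = f := by
  let ι : (kerStructureMap R M).obj Y ⟶ (forgetful R M).obj Y :=
    ModuleCat.ofHom (Y := (forgetful R M).obj Y) (LinearMap.ker (structureMap Y)).subtype
  have : Mono ι := (ModuleCat.mono_iff_injective ι).2 Subtype.val_injective
  let φ := coind.lift (Injective.factorThru f ι)
  have hφ : (kerStructureMap R M).map φ ≫ (coind.kerStructureMapEquiv E).toModuleIso.hom = f :=
    ModuleCat.hom_ext <| LinearMap.ext fun y =>
      (congrArg (Injective.factorThru f ι) (one_smul (TensorRing R M)ᵐᵒᵖ ((res Y).symm y.1))).trans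
        (congrArg (fun g => g.hom y) (Injective.comp_factorThru f ι))
  have hker : Mono ((kerStructureMap R M).map φ) := by
    have : Mono ((kerStructureMap R M).map φ ≫ _) := hφ ▸ ‹Mono f›
    exact mono_of_mono _ (coind.kerStructureMapEquiv E).toModuleIso.hom
  exact ⟨φ, (ModuleCat.mono_iff_injective φ).2
    (injective_of_kerStructureMap_injective hN ((ModuleCat.mono_iff_injective _).1 hker)), hφ⟩

theorem exists_epi_coind (hN : IsNilpotentBimodule R M N)
    [Subsingleton (Ext.{u} ((coind R M).obj (ModuleCat.of Rᵐᵒᵖ (RHom R M E))) Y 1)]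
    (g : E ⟶ (kerStructureMap R M).obj Y)
    (hg : ∀ k, Function.Surjective (RHom.map R (TPow R M k) g.hom)) :
    ∃ φ : (coind R M).obj E ⟶ Y, Epi φ ∧
      (coind.kerStructureMapEquiv E).symm.toModuleIso.hom ≫ (kerStructureMap R M).map φ = g := by
  have : Subsingleton (Ext.{u} (coind.coindSequence R M E).X₃ Y 1) := ‹_›
  obtain ⟨(φ : (coind R M).obj E ⟶ Y), hφ⟩ :=
    exists_f_comp_eq (coind.coindSequence_shortExact R M E) ((trivHomEquiv E Y).symm g)
  have hφg : (coind.kerStructureMapEquiv E).symm.toModuleIso.hom ≫ (kerStructureMap R M).map φ =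
      g := congrArg (trivHomEquiv E Y) hφ
  have hker (k : ℕ) : Function.Surjective
      (RHom.map R (TPow R M k) ((kerStructureMap R M).map φ).hom) := fun θ => by
    obtain ⟨ψ, hψ⟩ := hg k θ
    refine ⟨RHom.map R (TPow R M k) (coind.kerStructureMapEquiv E).symm.toLinearMap ψ,
      Eq.trans ?_ hψ⟩
    exact congrArg (fun f : E ⟶ _ => RHom.map R (TPow R M k) f.hom ψ) hφg
  exact ⟨φ, (ModuleCat.epi_iff_surjective φ).2 (surjective_of_kerStructureMap_surjective hN
    (coind.actionMap_surjective E) hker), hφg⟩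

section CoAdmissible

variable (hN : IsNilpotentBimodule R M N) (hadm : IsCoAdmissible R M)
  (hY : Psi R M (gorensteinInjective Rᵐᵒᵖ) Y)

include hN hadm hY

theorem Psi.exists_cosyzygy :
    ∃ Z, Psi R M (gorensteinInjective Rᵐᵒᵖ) Z ∧ IsCosyzygy Y Z := by
  obtain ⟨D, hD, E, (f : (kerStructureMap R M).obj Y ⟶ E), g, w, hE, hS⟩ := hY.2.exists_cosyzygy
  have : Mono f := hS.mono_f
  obtain ⟨φ, hφ, hφf⟩ := exists_mono_coind hN f
  let T : ShortComplex (ModuleCat.{u} (TensorRing R M)ᵐᵒᵖ) :=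
    .mk φ (Limits.cokernel.π φ) (Limits.cokernel.condition φ)
  have hT : T.ShortExact := { exact := ShortComplex.exact_cokernel φ }
  have hKT := kerStructureMap_shortExact hT hY.1
  have : Injective T.X₂ := inferInstanceAs (Injective ((coind R M).obj E))
  refine ⟨T.X₃, ⟨?_, ?_⟩, isCosyzygy_of_shortExact hT⟩
  · have : Subsingleton (Ext.{u} (ModuleCat.of Rᵐᵒᵖ M) (T.map (forgetful R M)).X₁ 1) :=
      ext_forgetful_subsingleton hN hY.1 (hadm.ext_hom_gorenstein _ hY.2)
    exact structureMap_surjective_of_map (g := T.g) (coind.structureMap_surjective E)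
      (RHom.map_surjective_of_ext M (shortExact_map_restrictScalars _ hT))
  · let e : D ≅ (kerStructureMap R M).obj T.X₃ :=
      Limits.CokernelCofork.mapIsoOfIsColimit hS.gIsCokernel hKT.gIsCokernel
        (Arrow.isoMk (Iso.refl _) (coind.kerStructureMapEquiv E).toModuleIso.symm
          ((Category.id_comp _).trans
            ((Iso.comp_inv_eq (coind.kerStructureMapEquiv E).toModuleIso).2 hφf.symm).symm))
    exact ObjectProperty.prop_of_iso _ e hD

theorem ext_coind_RHom_subsingleton [Injective E] {i : ℕ} (hi : i ≤ N + 1) : Subsingleton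
    (Ext.{u} ((coind R M).obj (ModuleCat.of Rᵐᵒᵖ (RHom R (TPow R M i) E))) Y 1) := by
  induction hi using Nat.decreasingInduction with
  | self =>
    have : Subsingleton (TPow R M (N + 1)) := hN
    have hzero : Limits.IsZero (ModuleCat.of Rᵐᵒᵖ (RHom R (TPow R M (N + 1)) E)) :=
      have : Subsingleton (RHom R (TPow R M (N + 1)) E) :=
        ⟨fun f g => RHom.ext fun x => by rw [Subsingleton.elim x 0, map_zero, map_zero]⟩
      ModuleCat.isZero_of_subsingleton _
    have := ((coind R M).map_isZero hzero).projective
    exact subsingleton_of_forall_eq 0 Ext.eq_zero_of_projective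
  | of_succ i _ ih =>
    let S := coind.coindSequence R M (ModuleCat.of Rᵐᵒᵖ (RHom R (TPow R M i) E))
    have : Subsingleton (Ext.{u} S.X₁ Y 1) :=
      (ext_triv_subsingleton_iff hY.1 _).2 (hadm.ext_hom_injective _ E hY.2 ‹_› i)
    have : Subsingleton (Ext.{u} S.X₃ Y 1) := ext_subsingleton_of_retract_left
      (.ofIso ((coind R M).mapIso (RHom.curry R M E i).symm.toModuleIso)) Y 1
    exact ext_subsingleton_X₂_left (coind.coindSequence_shortExact R M _) 1

theorem ext_injective_subsingleton (I : ModuleCat.{u} (TensorRing R M)ᵐᵒᵖ) [Injective I] :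
    Subsingleton (Ext.{u} I Y 1) := by
  obtain ⟨E, hE, ⟨h⟩⟩ := exists_retract_coind R M I
  have := ext_coind_RHom_subsingleton hN hadm hY (E := E) (Nat.zero_le (N + 1))
  have : Subsingleton (Ext.{u} ((coind R M).obj E) Y 1) := ext_subsingleton_of_retract_left
    (.ofIso ((coind R M).mapIso (RHom.evalOne R M E).symm.toModuleIso)) Y 1
  exact ext_subsingleton_of_retract_left h Y 1

theorem Psi.exists_syzygy :
    ∃ Z, Psi R M (gorensteinInjective Rᵐᵒᵖ) Z ∧ IsCosyzygy Z Y := by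
  obtain ⟨D, hD, E, f, g, w, hE, hS⟩ := hY.2.exists_syzygy
  have := ext_coind_RHom_subsingleton hN hadm hY (E := E) (Nat.le_add_left 1 N)
  have : Subsingleton (Ext.{u} ((coind R M).obj (ModuleCat.of Rᵐᵒᵖ (RHom R M E))) Y 1) :=
    ext_subsingleton_of_retract_left (.ofIso ((coind R M).mapIso
      ((RHom.curry R M E 0 ≪≫ₗ RHom.mapEquiv R M (RHom.evalOne R M E)).symm.toModuleIso))) Y 1
  obtain ⟨φ, hφ, hφg⟩ := exists_epi_coind (Y := Y) hN g
    (RHom.map_TPow_surjective_of_ext hS (hadm.ext_hom_gorenstein D hD))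
  let T : ShortComplex (ModuleCat.{u} (TensorRing R M)ᵐᵒᵖ) :=
    .mk (Limits.kernel.ι φ) φ (Limits.kernel.condition φ)
  have hT : T.ShortExact := { exact := ShortComplex.exact_kernel φ }
  have hg : Function.Surjective g := hS.moduleCat_surjective_g
  have hKT : (T.map (kerStructureMap R M)).ShortExact :=
    (kerStructureMap_shortExact_iff hT).2 fun y =>
      let ⟨x, hx⟩ := hg y
      ⟨_, (congrArg (fun f => f.hom x) hφg).trans hx⟩
  have : Injective T.X₂ := inferInstanceAs (Injective ((coind R M).obj E))
  refine ⟨T.X₁, ⟨structureMap_X₁_surjective hT (coind.structureMap_surjective E) hKT, ?_⟩,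
    isCosyzygy_of_shortExact hT⟩
  let e : D ≅ (kerStructureMap R M).obj T.X₁ :=
    Limits.KernelFork.mapIsoOfIsLimit hS.fIsKernel hKT.fIsKernel
      (Arrow.isoMk (coind.kerStructureMapEquiv E).symm.toModuleIso (Iso.refl _)
        (hφg.trans (Category.comp_id g).symm))
  exact ObjectProperty.prop_of_iso _ e hD

end CoAdmissible

theorem Psi_le_gorensteinInjective (hN : IsNilpotentBimodule R M N) (hadm : IsCoAdmissible R M) :
    Psi R M (gorensteinInjective Rᵐᵒᵖ) ≤ gorensteinInjective (TensorRing R M)ᵐᵒᵖ :=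
  gorensteinInjective_of_isCosyzygy (fun _ => Psi.exists_cosyzygy hN hadm)
    (fun _ => Psi.exists_syzygy hN hadm)
    (fun I _ _ hY => ext_injective_subsingleton hN hadm hY I)

end Backward

end TensorRings

end

theorem mainTheorem4 (R : Type u) [Ring R] (M : Type u) [AddCommGroup M] [Module R M]
    [Module Rᵐᵒᵖ M] [SMulCommClass R Rᵐᵒᵖ M] (N : ℕ)
    (hN : TensorRings.IsNilpotentBimodule R M N)
    (hcomp : TensorRings.IsCoCompatible R M M) (hadm : TensorRings.IsCoAdmissible R M) :
    TensorRings.gorensteinInjective (TensorRings.TensorRing R M)ᵐᵒᵖ =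
      TensorRings.Psi R M (TensorRings.gorensteinInjective Rᵐᵒᵖ) := by
  exact le_antisymm (TensorRings.gorensteinInjective_le_Psi hcomp)
    (TensorRings.Psi_le_gorensteinInjective hN hadm)
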